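/- Let $V$ be a Euclidean Jordan algebra, i.e. a finite-dimensional real inner product space with a bilinear commutative product $\bullet$ with unit $e$ such that $x\bullet(x^2\bullet y)=x^2\bullet(x\bullet y)$ and $\langle x\bullet y,z\rangle=\langle y,x\bullet z\rangle$ for all $x,y,z\in V$. Let $K=\{x\bullet x: x\in V\}$ be its cone of squares, with interior $K^\circ$ (the symmetric cone of $V$). Write $u\le_K v$ if $v-u\in K$, and for $u,v\in K^\circ$ let $M(u/v)=\inf\{\beta>0: u\le_K\beta v\}$ and let $\delta_K(u,v)=\log\big(M(u/v)\,M(v/u)\big)$ be Hilbert's metric. Every $z\in V$ can be written, uniquely up to order, as $z=\lambda_1c_1+\cdots+\lambda_kc_k$ with distinct real numbers $\lambda_i$ and nonzero elements $c_i$ satisfying $c_i^2=c_i$, $c_i\bullet c_j=0$ for $i\ne j$, and $c_1+\cdots+c_k=e$; put $\sigma(z)=\{\lambda_1,\dots,\lambda_k\}$ and, for $z\in K^\circ$ (where all $\lambda_i>0$), $z^{-1/2}=\sum_i\lambda_i^{-1/2}c_i$. Let $P(z)w=2\,z\bullet(z\bullet w)-z^2\bullet w$ be the quadratic representation. Let $\varphi\in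 K^\circ$ and $\Sigma_\varphi^\circ=\{x\in K^\circ:\langle\varphi,x\rangle=1\}$. A geodesic segment connecting $x$ and $y$ in $(\Sigma_\varphi^\circ,\delta_K)$ is the image of a map $\gamma:[a,b]\to\Sigma_\varphi^\circ$ with $\gamma(a)=x$, $\gamma(b)=y$ and $\delta_K(\gamma(s),\gamma(t))=|s-t|$ for all $s,t\in[a,b]$. Then for all distinct $x,y\in\Sigma_\varphi^\circ$ there exists a unique geodesic segment connecting $x$ and $y$ in $(\Sigma_\varphi^\circ,\delta_K)$ if and only if $\sigma(P(y^{-1/2})x)=\{\alpha,\beta\}$ for some $\beta>\alpha>0$. -/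

import Mathlib

/-- A Euclidean Jordan algebra structure on a real inner product space `V` (taken to be
finite-dimensional wherever it is used): a bilinear commutative product with unit `e`, satisfying
the Jordan identity, for which every multiplication operator `L(x)` is symmetric. -/
structure EuclideanJordanAlgebra (V : Type*) [NormedAddCommGroup V] [InnerProductSpace ℝ V] where
  /-- The multiplication operator `L(x) : y ↦ x • y`, linear in `x` and in `y`. -/
  L : V →ₗ[ℝ] V →ₗ[ℝ] V
  /-- The unit. -/
  e : V
  mul_comm : ∀ x y : V, L x y = L y x
  jordan : ∀ x y : V, L x (L (L x x) y) = L (L x x) (L x y)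
  symm : ∀ x y z : V, inner ℝ (L x y) z = inner ℝ y (L x z)
  unit_mul : ∀ x : V, L e x = x

namespace EuclideanJordanAlgebra

variable {V : Type*} [NormedAddCommGroup V] [InnerProductSpace ℝ V]

/-- The cone of squares `K`. -/
def cone (J : EuclideanJordanAlgebra V) : Set V := {z | ∃ x : V, z = J.L x x}

/-- The symmetric cone `K°`, the interior of the cone of squares. -/
def symmetricCone (J : EuclideanJordanAlgebra V) : Set V := interior J.cone

/-- The quadratic representation `P(x) = 2 L(x)² - L(x²)`. -/
def P (J : EuclideanJordanAlgebra V) (x : V) : V →ₗ[ℝ] V :=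
  (2 : ℝ) • (J.L x ∘ₗ J.L x) - J.L (J.L x x)

/-- A spectral decomposition `x = λ₁ c₁ + ⋯ + λₖ cₖ`, with distinct real `λᵢ` and a complete system
of orthogonal (nonzero) idempotents `cᵢ`. -/
structure SpectralDecomposition (J : EuclideanJordanAlgebra V) (x : V) where
  k : ℕ
  eigenvalue : Fin k → ℝ
  c : Fin k → V
  eigenvalue_injective : Function.Injective eigenvalue
  c_ne_zero : ∀ i, c i ≠ 0
  c_idempotent : ∀ i, J.L (c i) (c i) = c i
  c_orthogonal : ∀ i j, i ≠ j → J.L (c i) (c j) = 0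
  c_sum : ∑ i, c i = J.e
  sum_eq : x = ∑ i, eigenvalue i • c i

/-- The spectrum `σ(x)`: the set of the eigenvalues `λᵢ` in the spectral decomposition of `x`. -/
def spectrum (J : EuclideanJordanAlgebra V) (x : V) : Set ℝ :=
  {r | ∃ D : J.SpectralDecomposition x, ∃ i, D.eigenvalue i = r}

open Classical in
/-- The spectral calculus `f(x) = f(λ₁) c₁ + ⋯ + f(λₖ) cₖ`. By the spectral theorem a spectral
decomposition of `x` exists and is unique up to the order of its terms, so the value does not
depend on the choice made here, and the value `0` is never taken for lack of a decomposition. -/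
noncomputable def calculus (J : EuclideanJordanAlgebra V) (f : ℝ → ℝ) (x : V) : V :=
  if h : Nonempty (J.SpectralDecomposition x) then
    ∑ i, f (h.some.eigenvalue i) • h.some.c i
  else 0

/-- The element `y^{-1/2}` for `y ∈ K°` (all the eigenvalues of such a `y` are positive). -/
noncomputable def invSqrt (J : EuclideanJordanAlgebra V) (y : V) : V :=
  J.calculus (fun t => t ^ (-(1 / 2) : ℝ)) y

/-- The slice `Σ_φ° = {x ∈ K° : ⟨φ, x⟩ = 1}`. -/
def slice (J : EuclideanJordanAlgebra V) (φ : V) : Set V :=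
  {x | x ∈ J.symmetricCone ∧ inner ℝ φ x = 1}

end EuclideanJordanAlgebra

section Hilbert

variable {V : Type*} [AddCommGroup V] [Module ℝ V]

/-- `M(x/y; C) = inf {β > 0 : x ≤_C β y}`, where `x ≤_C z` means `z - x ∈ C`. -/
noncomputable def coneM (C : Set V) (x y : V) : ℝ :=
  sInf {β : ℝ | 0 < β ∧ β • y - x ∈ C}

/-- Hilbert's metric `δ_C(x, y) = log (M(x/y) M(y/x))`, for `x` and `y` that dominate each other
with respect to the cone `C` (as any two interior points of `C` do). -/
noncomputable def hilbertMetric (C : Set V) (x y : V) : ℝ :=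
  Real.log (coneM C x y * coneM C y x)

end Hilbert

/-- `S` is a geodesic segment connecting `x` and `y` in `(X, d)`: the image of a geodesic path
`γ : [a, b] → X` with `γ a = x` and `γ b = y`. -/
def IsGeodesicSegment {E : Type*} (X : Set E) (d : E → E → ℝ) (x y : E) (S : Set E) : Prop :=
  ∃ (a b : ℝ) (γ : ℝ → E), a ≤ b ∧
    (∀ t ∈ Set.Icc a b, γ t ∈ X) ∧
    (∀ s ∈ Set.Icc a b, ∀ t ∈ Set.Icc a b, d (γ s) (γ t) = |s - t|) ∧
    γ a = x ∧ γ b = y ∧ S = γ '' Set.Icc a b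

namespace EuclideanJordanAlgebra

variable {V : Type*} [NormedAddCommGroup V] [InnerProductSpace ℝ V]

/-! ### Linearised Jordan identities -/

/-! The operator `P(y^{-1/2})` is a linear automorphism of `K` sending `y` to `e`
(`exists_P_invSqrt_equiv`), so it preserves Hilbert's metric. Up to positive scaling, which the
metric ignores, the question concerns `e` and `z = ∑ λᵢ cᵢ`, the image of `x`. On the span of the
`cᵢ` the cone is an orthant, and distances are read off from the extreme ratios of coefficients.

Two geodesics from `e` to `z` are always available: the straight segment (`coeffPath_linear`) and
the geometric path, whose coefficients are powers of the `λᵢ` (`coeffPath_power`). If their images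
agree, comparing coefficients halfway along forces every `λᵢ` to be the smallest or the largest one
(`eq_or_eq_of_image_eq`).

Conversely let `z = α c + β d` with `c + d = e`. For `w` on a geodesic, equality holds in both
submultiplicativity bounds for `M`. The resulting order inequalities confine `a e - w` to the face
of `c` and `b w - e` to that of `d`, for suitable `a` and `b`, so `w` is a positive combination of
`c` and `d` fixed up to scale by its distance to `e` (`eq_smul_of_hilbertMetric_add`).

The supporting theory is the spectral theorem, self-duality of `K`, the Peirce decomposition, and
the invariance of `K` under `P`, obtained from a linear flow. -/

theorem jordan_linearized (J : EuclideanJordanAlgebra V) (x y z w : V) :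
    J.L x (J.L (J.L y z) w) + J.L y (J.L (J.L x z) w) + J.L z (J.L (J.L x y) w) =
      J.L (J.L y z) (J.L x w) + J.L (J.L x z) (J.L y w) + J.L (J.L x y) (J.L z w) := by
  have h1 := J.jordan x w
  have h2 := J.jordan y w
  have h3 := J.jordan z w
  have h4 := J.jordan (x + y) w
  have h5 := J.jordan (x + z) w
  have h6 := J.jordan (y + z) w
  have h7 := J.jordan (x + y + z) w
  simp only [map_add, LinearMap.add_apply, J.mul_comm y x, J.mul_comm z x, J.mul_comm z y]
    at h4 h5 h6 h7
  linear_combination (norm := module) (1 / 2 : ℝ) • (h7 - h4 - h5 - h6 + h1 + h2 + h3)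

/-- The linearised identity, read as an identity of operators in its third argument instead of its
last. It makes `L` of every power of `z` a polynomial in `L(z)` and `L(z²)`. -/
theorem L_mul_mul (J : EuclideanJordanAlgebra V) (x y w : V) :
    J.L (J.L (J.L x y) w) = J.L (J.L x w) * J.L y + J.L (J.L y w) * J.L x + J.L (J.L x y) * J.L w
      - J.L x * J.L w * J.L y - J.L y * J.L w * J.L x := by
  ext z
  have h := J.jordan_linearized x y z w
  rw [J.mul_comm (J.L y z) w, J.mul_comm (J.L x z) w, J.mul_comm z (J.L (J.L x y) w),
    J.mul_comm (J.L y z) (J.L x w), J.mul_comm (J.L x z) (J.L y w), J.mul_comm z w] at h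
  simp only [LinearMap.sub_apply, LinearMap.add_apply, Module.End.mul_apply]
  linear_combination (norm := module) h

theorem isSymmetric_L (J : EuclideanJordanAlgebra V) (x : V) : (J.L x).IsSymmetric :=
  fun y z => J.symm x y z

theorem mul_unit (J : EuclideanJordanAlgebra V) (x : V) : J.L x J.e = x := by
  rw [J.mul_comm, J.unit_mul]

theorem L_unit (J : EuclideanJordanAlgebra V) : J.L J.e = 1 := by
  ext x; simp [J.unit_mul]

/-! ### Idempotents -/

theorem L_idempotent_cube (J : EuclideanJordanAlgebra V) {c : V} (hc : J.L c c = c) (v : V) :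
    (2 : ℝ) • J.L c (J.L c (J.L c v)) = (3 : ℝ) • J.L c (J.L c v) - J.L c v := by
  have h := congrArg (fun T : V →ₗ[ℝ] V => T v) (J.L_mul_mul c c c)
  simp only [hc, LinearMap.sub_apply, LinearMap.add_apply, Module.End.mul_apply] at h
  linear_combination (norm := module) h

/-- By the cubic identity, `L(c)` has eigenvalues among `0`, `1/2`, `1`, and `t = t² + 4(t - t²)²`
holds at these three values. Hence `L(c)` is positive semidefinite. -/
theorem inner_L_idempotent (J : EuclideanJordanAlgebra V) {c : V} (hc : J.L c c = c) (v : V) :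
    inner ℝ (J.L c v) v =
      ‖J.L c v‖ ^ 2 + 4 * ‖J.L c v - J.L c (J.L c v)‖ ^ 2 := by
  have h1 := congrArg (fun u => inner ℝ u v) (J.L_idempotent_cube hc v)
  have h2 := congrArg (fun u => inner ℝ (J.L c u) v) (J.L_idempotent_cube hc v)
  rw [← real_inner_self_eq_norm_sq, ← real_inner_self_eq_norm_sq]
  simp only [map_smul, map_sub, inner_sub_left, inner_sub_right, inner_smul_left,
    RCLike.conj_to_real] at h1 h2 ⊢
  have e1 : inner ℝ (J.L c v) (J.L c v) = inner ℝ (J.L c (J.L c v)) v := (J.symm c _ v).symm ▸ by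
    rw [J.symm]
  have e2 : inner ℝ (J.L c v) (J.L c (J.L c v)) = inner ℝ (J.L c (J.L c (J.L c v))) v := by
    rw [real_inner_comm, ← J.symm]
  have e3 : inner ℝ (J.L c (J.L c v)) (J.L c v) = inner ℝ (J.L c (J.L c (J.L c v))) v := by
    rw [← J.symm]
  have e4 : inner ℝ (J.L c (J.L c v)) (J.L c (J.L c v)) =
      inner ℝ (J.L c (J.L c (J.L c (J.L c v)))) v := by
    rw [← J.symm, ← J.symm]
  rw [e1, e2, e3, e4]
  linarith

theorem inner_L_idempotent_nonneg (J : EuclideanJordanAlgebra V) {c : V} (hc : J.L c c = c)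
    (v : V) : 0 ≤ inner ℝ (J.L c v) v := by
  rw [J.inner_L_idempotent hc]; positivity

theorem L_idempotent_eq_zero (J : EuclideanJordanAlgebra V) {c : V} (hc : J.L c c = c) {v : V}
    (hv : inner ℝ (J.L c v) v = 0) : J.L c v = 0 := by
  rw [J.inner_L_idempotent hc] at hv
  have h2 := sq_nonneg ‖J.L c v - J.L c (J.L c v)‖
  have h3 := sq_nonneg (‖J.L c v‖)
  have h1 : ‖J.L c v‖ ^ 2 = 0 := by linarith
  simpa using h1

theorem commute_L_of_orthogonal (J : EuclideanJordanAlgebra V) {c d : V} (hc : J.L c c = c)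
    (hcd : J.L c d = 0) : Commute (J.L c) (J.L d) := by
  ext w
  have h := J.jordan_linearized c c d w
  simp only [hcd, hc, map_zero, LinearMap.zero_apply, zero_add] at h
  simp [h]

/-- The Jordan identity gives `x • (x² • c) = x² • (x • c) = 0`; pairing with `x` yields `⟨c • x²,
x²⟩ = 0`, and `L(c)` is semidefinite. -/
theorem L_mul_self_eq_zero (J : EuclideanJordanAlgebra V) {c x : V} (hc : J.L c c = c)
    (h : J.L c x = 0) : J.L c (J.L x x) = 0 := by
  apply J.L_idempotent_eq_zero hc
  have h1 := J.jordan x c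
  rw [J.mul_comm x c, h, map_zero, J.mul_comm (J.L x x) c] at h1
  rw [← J.symm, h1, inner_zero_left]

/-! ### Power associativity -/

/-- The `n`-th power of `z`. -/
def pow (J : EuclideanJordanAlgebra V) (z : V) (n : ℕ) : V := (J.L z ^ n) J.e

theorem pow_succ_eq (J : EuclideanJordanAlgebra V) (z : V) (n : ℕ) :
    J.pow z (n + 1) = J.L z (J.pow z n) := by
  simp [pow, pow_succ']

theorem pow_one_eq (J : EuclideanJordanAlgebra V) (z : V) : J.pow z 1 = z := by
  simp [pow, J.mul_unit]

theorem L_pow_add_two (J : EuclideanJordanAlgebra V) (z : V) (n : ℕ) :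
    J.L (J.pow z (n + 2)) = J.L (J.L z z) * J.L (J.pow z n) + J.L (J.pow z (n + 1)) * J.L z +
      J.L (J.pow z (n + 1)) * J.L z - J.L z * J.L z * J.L (J.pow z n)
      - J.L (J.pow z n) * J.L z * J.L z := by
  have h := J.L_mul_mul z (J.pow z n) z
  rw [J.mul_comm (J.pow z n) z, ← pow_succ_eq, J.mul_comm _ z, ← pow_succ_eq] at h
  exact h

theorem commute_L_pow (J : EuclideanJordanAlgebra V) {z : V} {T : V →ₗ[ℝ] V}
    (h1 : Commute T (J.L z)) (h2 : Commute T (J.L (J.L z z))) (n : ℕ) :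
    Commute T (J.L (J.pow z n)) := by
  induction n using Nat.twoStepInduction with
  | zero => simp [pow, J.L_unit]
  | one => rwa [J.pow_one_eq]
  | more n ih1 ih2 =>
    rw [L_pow_add_two]
    exact ((((h2.mul_right ih1).add_right (ih2.mul_right h1)).add_right
      (ih2.mul_right h1)).sub_right ((h1.mul_right h1).mul_right ih1)).sub_right
      ((ih1.mul_right h1).mul_right h1)

theorem commute_L_L_pow (J : EuclideanJordanAlgebra V) (z : V) (n : ℕ) :
    Commute (J.L z) (J.L (J.pow z n)) :=
  J.commute_L_pow (Commute.refl _) (by ext y; simp [J.jordan z y]) n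

theorem L_pow_pow (J : EuclideanJordanAlgebra V) (z : V) (m n : ℕ) :
    J.L (J.pow z m) (J.pow z n) = J.pow z (m + n) := by
  have h := ((J.commute_L_L_pow z m).symm.pow_right n).eq
  have h2 := congrArg (fun T : V →ₗ[ℝ] V => T J.e) h
  simp only [Module.End.mul_apply, J.mul_unit] at h2
  rw [pow, pow, pow] at *
  rw [h2, add_comm, pow_add, Module.End.mul_apply]

-- Polynomials in `z` multiply associatively, which lets Lagrange interpolation produce idempotents
-- below.
open Polynomial in
theorem L_aeval_aeval (J : EuclideanJordanAlgebra V) (z : V) (p q : ℝ[X]) :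
    J.L (aeval (J.L z) p J.e) (aeval (J.L z) q J.e) = aeval (J.L z) (p * q) J.e := by
  induction p using Polynomial.induction_on' with
  | add p₁ p₂ h₁ h₂ => simp [add_mul, h₁, h₂]
  | monomial m a =>
    induction q using Polynomial.induction_on' with
    | add q₁ q₂ h₁ h₂ => simp only [map_add, mul_add, LinearMap.add_apply, h₁, h₂]
    | monomial n b =>
      have := J.L_pow_pow z m n
      simp only [pow] at this
      simp [Polynomial.aeval_monomial, monomial_mul_monomial, Algebra.algebraMap_eq_smul_one, this,
        smul_smul, _root_.mul_comm b a]

end EuclideanJordanAlgebra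

namespace EuclideanJordanAlgebra

variable {V : Type*} [NormedAddCommGroup V] [InnerProductSpace ℝ V]

/-! ### Complete systems of orthogonal idempotents -/

/-- A complete system of nonzero orthogonal idempotents. -/
structure CompleteSystem (J : EuclideanJordanAlgebra V) {ι : Type*} [Fintype ι] (c : ι → V) :
    Prop where
  ne_zero : ∀ i, c i ≠ 0
  idem : ∀ i, J.L (c i) (c i) = c i
  orth : ∀ i j, i ≠ j → J.L (c i) (c j) = 0
  sum_eq : ∑ i, c i = J.e

theorem SpectralDecomposition.completeSystem {J : EuclideanJordanAlgebra V} {x : V}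
    (D : J.SpectralDecomposition x) : J.CompleteSystem D.c :=
  ⟨D.c_ne_zero, D.c_idempotent, D.c_orthogonal, D.c_sum⟩

namespace CompleteSystem

variable {J : EuclideanJordanAlgebra V} {ι : Type*} [Fintype ι] {c : ι → V}

theorem mul_eq [DecidableEq ι] (hc : J.CompleteSystem c) (i j : ι) :
    J.L (c i) (c j) = if i = j then c j else 0 := by
  split_ifs with h
  · rw [h, hc.idem]
  · exact hc.orth i j h

theorem inner_eq_zero (hc : J.CompleteSystem c) {i j : ι} (h : i ≠ j) :
    inner ℝ (c i) (c j) = 0 := by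
  rw [← J.mul_unit (c i), J.symm, hc.orth i j h, inner_zero_right]

theorem mul_sum_smul (hc : J.CompleteSystem c) (a b : ι → ℝ) :
    J.L (∑ i, a i • c i) (∑ i, b i • c i) = ∑ i, (a i * b i) • c i := by
  classical
  simp [LinearMap.sum_apply, map_sum, hc.mul_eq, smul_smul, _root_.mul_comm]

theorem mul_sum_apply (hc : J.CompleteSystem c) (a : ι → ℝ) (j : ι) :
    J.L (∑ i, a i • c i) (c j) = a j • c j := by
  classical
  simp [LinearMap.sum_apply, hc.mul_eq]

theorem inner_sum_smul (hc : J.CompleteSystem c) (a : ι → ℝ) (j : ι) :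
    inner ℝ (∑ i, a i • c i) (c j) = a j * ‖c j‖ ^ 2 := by
  classical
  rw [sum_inner, Finset.sum_eq_single j]
  · rw [real_inner_smul_left, real_inner_self_eq_norm_sq]
  · intro i _ hij
    rw [real_inner_smul_left, hc.inner_eq_zero hij, mul_zero]
  · simp

theorem coeff_ext (hc : J.CompleteSystem c) {a b : ι → ℝ}
    (h : ∑ i, a i • c i = ∑ i, b i • c i) (j : ι) : a j = b j := by
  have h1 := hc.inner_sum_smul a j
  rw [h, hc.inner_sum_smul] at h1
  have h2 : ‖c j‖ ^ 2 ≠ 0 := by simpa using hc.ne_zero j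
  exact (mul_right_cancel₀ h2 h1).symm

open Polynomial in
theorem aeval_sum_smul (hc : J.CompleteSystem c) (a : ι → ℝ) (p : ℝ[X]) :
    aeval (J.L (∑ i, a i • c i)) p J.e = ∑ i, p.eval (a i) • c i := by
  induction p using Polynomial.induction_on' with
  | add p q hp hq =>
    rw [map_add, LinearMap.add_apply, hp, hq]
    simp [add_smul, Finset.sum_add_distrib]
  | monomial n r =>
    simp only [aeval_monomial, Module.End.mul_apply, Module.algebraMap_end_apply, eval_monomial,
      mul_smul, ← Finset.smul_sum]
    congr 1
    induction n with
    | zero => simp [hc.sum_eq]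
    | succ n ih => rw [pow_succ', Module.End.mul_apply, ih, hc.mul_sum_smul]; simp [pow_succ']

end CompleteSystem

/-! ### The spectral theorem -/

-- The symmetric operator `L(z)` is diagonalisable, so `p(L(z))` depends only on the values of `p`
-- at the eigenvalues. The Lagrange basis polynomials, applied to `L(z)` and then to `e`, are the
-- required idempotents.
open Polynomial in
theorem nonempty_spectralDecomposition [FiniteDimensional ℝ V] (J : EuclideanJordanAlgebra V)
    (z : V) : Nonempty (J.SpectralDecomposition z) := by
  classical
  have hT := J.isSymmetric_L z
  set T := J.L z with hTdef
  let S : Finset ℝ := Finset.univ.image (hT.eigenvalues rfl)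
  have key : ∀ p : ℝ[X], (∀ r ∈ S, p.eval r = 0) → aeval T p = 0 := by
    intro p hp
    apply (hT.eigenvectorBasis rfl).toBasis.ext
    intro i
    have h1 : p.eval (hT.eigenvalues rfl i) = 0 := hp _ (Finset.mem_image_of_mem _ (Finset.mem_univ i))
    have h2 := Module.End.aeval_apply_of_hasEigenvector (p := p)
      (hT.hasEigenvector_eigenvectorBasis rfl i)
    simpa [h1] using h2
  have key2 : ∀ p q : ℝ[X], (∀ r ∈ S, p.eval r = q.eval r) → aeval T p = aeval T q := by
    intro p q h
    rw [← sub_eq_zero, ← map_sub]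
    exact key _ fun r hr => by simp [h r hr]
  let b : ℝ → ℝ[X] := fun r => Lagrange.basis S id r
  have hb : ∀ r ∈ S, ∀ s ∈ S, (b r).eval s = if s = r then 1 else 0 := by
    intro r hr s hs
    split_ifs with h
    · subst h
      exact Lagrange.eval_basis_self (v := id) Function.injective_id.injOn hs
    · exact Lagrange.eval_basis_of_ne (v := id) (Ne.symm h) hs
  let c : ℝ → V := fun r => aeval T (b r) J.e
  have hmul : ∀ r ∈ S, ∀ s ∈ S, J.L (c r) (c s) = if r = s then c s else 0 := by
    intro r hr s hs
    simp only [c, hTdef]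
    rw [J.L_aeval_aeval]
    have : aeval T (b r * b s) = aeval T (if r = s then b s else 0) := by
      apply key2
      intro t ht
      rw [eval_mul, hb r hr t ht, hb s hs t ht]
      split_ifs <;> simp_all
    rw [← hTdef, this]
    split_ifs <;> simp
  have hsum : ∑ r ∈ S, c r = J.e := by
    have : aeval T (∑ r ∈ S, b r) = aeval T (1 : ℝ[X]) := by
      apply key2
      intro t ht
      rw [eval_finsetSum, Finset.sum_congr rfl fun r hr => hb r hr t ht]
      simp [ht]
    have h2 := congrArg (fun A : V →ₗ[ℝ] V => A J.e) this
    simpa [c, map_sum, LinearMap.sum_apply] using h2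
  have hz : ∑ r ∈ S, r • c r = z := by
    have : aeval T (∑ r ∈ S, C r * b r) = aeval T (X : ℝ[X]) := by
      apply key2
      intro t ht
      rw [eval_finsetSum]
      simp only [eval_mul, eval_C, eval_X]
      rw [Finset.sum_congr rfl fun r hr => by rw [hb r hr t ht]]
      simp [ht]
    have h2 := congrArg (fun A : V →ₗ[ℝ] V => A J.e) this
    simpa [c, map_sum, LinearMap.sum_apply, hTdef, J.mul_unit] using h2
  -- `L(z)` may also have eigenvalues `(λᵢ + λⱼ)/2` outside the spectrum of `z`; their idempotents
  -- vanish and are discarded.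
  let S' := S.filter fun r => c r ≠ 0
  have hS : ∀ i : Fin S'.card, ((S'.equivFin.symm i : S') : ℝ) ∈ S := fun i =>
    (Finset.mem_filter.1 (S'.equivFin.symm i).2).1
  have hred : ∀ f : ℝ → V, (∀ r, c r = 0 → f r = 0) →
      ∑ i, f (S'.equivFin.symm i : S') = ∑ r ∈ S, f r := by
    intro f hf
    rw [Equiv.sum_comp S'.equivFin.symm (fun r : S' => f r), Finset.sum_coe_sort S' f]
    apply Finset.sum_subset (Finset.filter_subset _ _)
    intro r hr hr'
    apply hf
    by_contra h
    exact hr' (Finset.mem_filter.2 ⟨hr, h⟩)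
  exact ⟨{
    k := S'.card
    eigenvalue := fun i => (S'.equivFin.symm i : S')
    c := fun i => c (S'.equivFin.symm i : S')
    eigenvalue_injective := Subtype.val_injective.comp S'.equivFin.symm.injective
    c_ne_zero := fun i => (Finset.mem_filter.1 (S'.equivFin.symm i).2).2
    c_idempotent := fun i => by rw [hmul _ (hS i) _ (hS i), if_pos rfl]
    c_orthogonal := fun i j hij => by
      rw [hmul _ (hS i) _ (hS j), if_neg]
      exact fun h => hij (S'.equivFin.symm.injective (Subtype.ext h))
    c_sum := by rw [hred c fun r h => h, hsum]
    sum_eq := by rw [hred (fun r => r • c r) fun r h => by simp [h], hz] }⟩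

-- The polynomial with roots the eigenvalues of `D'` annihilates `x`, hence vanishes at each
-- eigenvalue of `D`.
open Polynomial in
theorem SpectralDecomposition.range_subset {J : EuclideanJordanAlgebra V} {x : V}
    (D D' : J.SpectralDecomposition x) (i : Fin D.k) : ∃ j, D'.eigenvalue j = D.eigenvalue i := by
  let p : ℝ[X] := ∏ j, (X - C (D'.eigenvalue j))
  have h' := D'.completeSystem.aeval_sum_smul D'.eigenvalue p
  have h := D.completeSystem.aeval_sum_smul D.eigenvalue p
  rw [← D.sum_eq] at h
  rw [← D'.sum_eq, h] at h'
  have h0 : ∑ j, p.eval (D'.eigenvalue j) • D'.c j = 0 := by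
    apply Finset.sum_eq_zero
    intro j _
    have : p.eval (D'.eigenvalue j) = 0 := by
      rw [eval_prod]
      exact Finset.prod_eq_zero (Finset.mem_univ j) (by simp)
    simp [this]
  have h1 := D.completeSystem.coeff_ext (a := fun i => p.eval (D.eigenvalue i)) (b := 0)
    (by rw [h', h0]; simp) i
  simp only [p, eval_prod, Pi.zero_apply, Finset.prod_eq_zero_iff] at h1
  obtain ⟨j, _, hj⟩ := h1
  exact ⟨j, by simp only [eval_sub, eval_X, eval_C] at hj; linarith⟩

theorem SpectralDecomposition.spectrum_eq {J : EuclideanJordanAlgebra V} {x : V}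
    (D : J.SpectralDecomposition x) : J.spectrum x = Set.range D.eigenvalue := by
  ext r
  constructor
  · rintro ⟨D', i, rfl⟩
    exact D'.range_subset D i
  · rintro ⟨i, rfl⟩
    exact ⟨D, i, rfl⟩

/-! ### The cone of squares -/

theorem CompleteSystem.sum_mem_cone {J : EuclideanJordanAlgebra V} {ι : Type*} [Fintype ι]
    {c : ι → V} (hc : J.CompleteSystem c) {a : ι → ℝ} (ha : ∀ i, 0 ≤ a i) :
    ∑ i, a i • c i ∈ J.cone := by
  refine ⟨∑ i, √(a i) • c i, ?_⟩
  rw [hc.mul_sum_smul]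
  simp [Real.mul_self_sqrt, ha]

theorem idempotent_mem_cone (J : EuclideanJordanAlgebra V) {c : V} (hc : J.L c c = c) :
    c ∈ J.cone := ⟨c, hc.symm⟩

theorem SpectralDecomposition.mem_cone {J : EuclideanJordanAlgebra V} {x : V}
    (D : J.SpectralDecomposition x) (h : ∀ i, 0 ≤ D.eigenvalue i) : x ∈ J.cone := by
  have := D.completeSystem.sum_mem_cone h
  rwa [← D.sum_eq] at this

theorem symmetricCone_subset (J : EuclideanJordanAlgebra V) : J.symmetricCone ⊆ J.cone :=
  interior_subset

/-- An interior point of the cone dominates a positive multiple of every vector. -/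
theorem exists_sub_smul_mem_cone (J : EuclideanJordanAlgebra V) {u : V}
    (hu : u ∈ J.symmetricCone) (v : V) : ∃ ε : ℝ, 0 < ε ∧ u - ε • v ∈ J.cone := by
  have hcont : Continuous fun ε : ℝ => u - ε • v := by fun_prop
  have h0 : (fun ε : ℝ => u - ε • v) 0 ∈ J.symmetricCone := by simpa using hu
  have h1 : ∀ᶠ ε in nhds (0 : ℝ), u - ε • v ∈ J.cone :=
    (hcont.continuousAt.eventually_mem (isOpen_interior.mem_nhds h0)).mono
      fun ε h => interior_subset h
  obtain ⟨δ, hδ, h⟩ := Metric.eventually_nhds_iff.1 h1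
  exact ⟨δ / 2, by positivity, h (by simp [abs_of_pos hδ, hδ])⟩

variable [FiniteDimensional ℝ V]

theorem inner_mul_self_nonneg (J : EuclideanJordanAlgebra V) {u : V} (hu : u ∈ J.cone) (x : V) :
    0 ≤ inner ℝ (J.L u x) x := by
  obtain ⟨v, rfl⟩ := hu
  obtain ⟨D⟩ := J.nonempty_spectralDecomposition v
  rw [D.sum_eq, D.completeSystem.mul_sum_smul]
  simp only [map_sum, map_smul, LinearMap.sum_apply, LinearMap.smul_apply, sum_inner,
    real_inner_smul_left]
  exact Finset.sum_nonneg fun i _ => mul_nonneg (mul_self_nonneg _)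
    (J.inner_L_idempotent_nonneg (D.c_idempotent i) x)

theorem inner_nonneg (J : EuclideanJordanAlgebra V) {u v : V} (hu : u ∈ J.cone)
    (hv : v ∈ J.cone) : 0 ≤ inner ℝ u v := by
  obtain ⟨x, rfl⟩ := hv
  rw [← J.symm, J.mul_comm]
  exact J.inner_mul_self_nonneg hu x

/-- Self-duality: testing against the spectral idempotents of `u` detects the signs of its
eigenvalues. Convexity and closedness of the cone follow. -/
theorem mem_cone_iff_inner (J : EuclideanJordanAlgebra V) (u : V) :
    u ∈ J.cone ↔ ∀ v ∈ J.cone, 0 ≤ inner ℝ u v := by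
  refine ⟨fun hu v hv => J.inner_nonneg hu hv, fun h => ?_⟩
  obtain ⟨D⟩ := J.nonempty_spectralDecomposition u
  apply D.mem_cone
  intro i
  have h1 := h _ (J.idempotent_mem_cone (D.c_idempotent i))
  have h2 := D.completeSystem.inner_sum_smul D.eigenvalue i
  rw [← D.sum_eq] at h2
  rw [h2] at h1
  exact nonneg_of_mul_nonneg_left h1 (by have := D.c_ne_zero i; positivity)

theorem CompleteSystem.sum_mem_cone_iff {J : EuclideanJordanAlgebra V} {ι : Type*} [Fintype ι]
    {c : ι → V} (hc : J.CompleteSystem c) {a : ι → ℝ} :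
    ∑ i, a i • c i ∈ J.cone ↔ ∀ i, 0 ≤ a i := by
  refine ⟨fun h i => ?_, hc.sum_mem_cone⟩
  have h1 := J.inner_nonneg h (J.idempotent_mem_cone (hc.idem i))
  rw [hc.inner_sum_smul] at h1
  exact nonneg_of_mul_nonneg_left h1 (by have := hc.ne_zero i; positivity)

theorem add_mem_cone (J : EuclideanJordanAlgebra V) {u v : V} (hu : u ∈ J.cone)
    (hv : v ∈ J.cone) : u + v ∈ J.cone := by
  rw [mem_cone_iff_inner] at *
  intro w hw
  rw [inner_add_left]
  exact add_nonneg (hu w hw) (hv w hw)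

theorem smul_mem_cone (J : EuclideanJordanAlgebra V) {r : ℝ} (hr : 0 ≤ r) {u : V}
    (hu : u ∈ J.cone) : r • u ∈ J.cone := by
  rw [mem_cone_iff_inner] at *
  intro w hw
  rw [real_inner_smul_left]
  exact mul_nonneg hr (hu w hw)

theorem isClosed_cone (J : EuclideanJordanAlgebra V) : IsClosed J.cone := by
  have : J.cone = ⋂ v ∈ J.cone, {u | 0 ≤ inner ℝ u v} := by
    ext u; simp [J.mem_cone_iff_inner u]
  rw [this]
  exact isClosed_biInter fun v _ => isClosed_le continuous_const
    (continuous_id.inner continuous_const)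

theorem eq_zero_of_mem_cone_of_neg_mem_cone (J : EuclideanJordanAlgebra V) {u : V}
    (hu : u ∈ J.cone) (hu' : -u ∈ J.cone) : u = 0 := by
  have h := J.inner_nonneg hu hu'
  rw [inner_neg_right, real_inner_self_eq_norm_sq] at h
  have : ‖u‖ ^ 2 = 0 := le_antisymm (by linarith) (by positivity)
  simpa using this

theorem mem_cone_of_L_nonneg (J : EuclideanJordanAlgebra V) {u : V}
    (h : ∀ x, 0 ≤ inner ℝ (J.L u x) x) : u ∈ J.cone := by
  obtain ⟨D⟩ := J.nonempty_spectralDecomposition u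
  apply D.mem_cone
  intro i
  have h1 := h (D.c i)
  have h2 := D.completeSystem.mul_sum_apply D.eigenvalue i
  rw [← D.sum_eq] at h2
  rw [h2, real_inner_smul_left, real_inner_self_eq_norm_sq] at h1
  exact nonneg_of_mul_nonneg_left h1 (by have := D.c_ne_zero i; positivity)

/-- If `L(u - e)` has operator norm below `1`, then `L(u) = 1 + L(u - e)` is positive semidefinite.
-/
theorem unit_mem_symmetricCone (J : EuclideanJordanAlgebra V) : J.e ∈ J.symmetricCone := by
  let Lc : V →ₗ[ℝ] (V →L[ℝ] V) :=
    (LinearMap.toContinuousLinearMap : (V →ₗ[ℝ] V) ≃ₗ[ℝ] (V →L[ℝ] V)).toLinearMap ∘ₗ J.L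
  have hcont : Continuous fun u => ‖Lc (u - J.e)‖ :=
    (Lc.continuous_of_finiteDimensional.comp (continuous_id.sub continuous_const)).norm
  rw [symmetricCone, mem_interior]
  refine ⟨{u | ‖Lc (u - J.e)‖ < 1}, ?_, isOpen_lt hcont continuous_const, by simp⟩
  intro u hu
  apply J.mem_cone_of_L_nonneg
  intro x
  have h1 : J.L u x = x + Lc (u - J.e) x := by
    change J.L u x = x + J.L (u - J.e) x
    simp [J.unit_mul]
  have h2 : |inner ℝ (Lc (u - J.e) x) x| ≤ ‖x‖ * ‖x‖ :=
    (abs_real_inner_le_norm _ _).trans (mul_le_mul_of_nonneg_right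
      (((Lc (u - J.e)).le_opNorm x).trans
        (mul_le_of_le_one_left (norm_nonneg _) (le_of_lt hu))) (norm_nonneg _))
  rw [h1, inner_add_left, real_inner_self_eq_norm_mul_norm]
  linarith [neg_le_of_abs_le h2]

theorem smul_mem_symmetricCone (J : EuclideanJordanAlgebra V) {r : ℝ} (hr : 0 < r) {u : V}
    (hu : u ∈ J.symmetricCone) : r • u ∈ J.symmetricCone := by
  rw [symmetricCone, mem_interior] at *
  obtain ⟨U, hU, hUo, huU⟩ := hu
  refine ⟨(fun v => r • v) '' U, ?_, (isOpenMap_smul₀ hr.ne') U hUo, ⟨u, huU, rfl⟩⟩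
  rintro _ ⟨v, hv, rfl⟩
  exact J.smul_mem_cone hr.le (hU hv)

theorem add_mem_symmetricCone (J : EuclideanJordanAlgebra V) {u v : V}
    (hu : u ∈ J.symmetricCone) (hv : v ∈ J.cone) : u + v ∈ J.symmetricCone := by
  rw [symmetricCone, mem_interior] at *
  obtain ⟨U, hU, hUo, huU⟩ := hu
  refine ⟨(fun w => w + v) '' U, ?_, (isOpenMap_add_right v) U hUo, ⟨u, huU, rfl⟩⟩
  rintro _ ⟨w, hw, rfl⟩
  exact J.add_mem_cone (hU hw) hv

theorem CompleteSystem.sum_mem_symmetricCone_iff {J : EuclideanJordanAlgebra V} {ι : Type*}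
    [Fintype ι] {c : ι → V} (hc : J.CompleteSystem c) {a : ι → ℝ} :
    ∑ i, a i • c i ∈ J.symmetricCone ↔ ∀ i, 0 < a i := by
  constructor
  · intro h i
    obtain ⟨ε, hε, h1⟩ := J.exists_sub_smul_mem_cone h J.e
    rw [← hc.sum_eq, Finset.smul_sum, ← Finset.sum_sub_distrib] at h1
    simp only [← sub_smul] at h1
    have := hc.sum_mem_cone_iff.1 h1 i
    linarith
  · intro h
    obtain ⟨ε, hε, h1⟩ : ∃ ε : ℝ, 0 < ε ∧ ∀ i, ε ≤ a i := by
      rcases isEmpty_or_nonempty ι with hι | hι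
      · exact ⟨1, one_pos, fun i => isEmptyElim i⟩
      · obtain ⟨i, hi⟩ := Finite.exists_min a
        exact ⟨a i, h i, hi⟩
    have h2 : ∑ i, a i • c i = ε • J.e + ∑ i, (a i - ε) • c i := by
      rw [← hc.sum_eq, Finset.smul_sum, ← Finset.sum_add_distrib]
      simp [← add_smul]
    rw [h2]
    exact J.add_mem_symmetricCone (J.smul_mem_symmetricCone hε J.unit_mem_symmetricCone)
      (hc.sum_mem_cone fun i => sub_nonneg.2 (h1 i))

theorem inner_pos (J : EuclideanJordanAlgebra V) {φ u : V} (hφ : φ ∈ J.symmetricCone)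
    (hu : u ∈ J.cone) (hu0 : u ≠ 0) : 0 < inner ℝ φ u := by
  obtain ⟨ε, hε, h⟩ := J.exists_sub_smul_mem_cone hφ u
  have h1 := J.inner_nonneg h hu
  rw [inner_sub_left, real_inner_smul_left, real_inner_self_eq_norm_sq] at h1
  have : 0 < ‖u‖ ^ 2 := by positivity
  nlinarith [mul_pos hε this]

end EuclideanJordanAlgebra

namespace EuclideanJordanAlgebra

variable {V : Type*} [NormedAddCommGroup V] [InnerProductSpace ℝ V]

/-! ### The Peirce decomposition -/

theorem eigenvalue_idempotent (J : EuclideanJordanAlgebra V) {d v : V} (hd : J.L d d = d)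
    (hv : v ≠ 0) {t : ℝ} (h : J.L d v = t • v) : t = 0 ∨ t = 1 / 2 ∨ t = 1 := by
  have h1 := J.L_idempotent_cube hd v
  simp only [h, map_smul, smul_smul, ← sub_smul] at h1
  have h2 := smul_left_injective ℝ hv h1
  have h3 : t * ((t - 1 / 2) * (t - 1)) = 0 := by linarith
  rcases mul_eq_zero.1 h3 with h | h
  · exact Or.inl h
  · rcases mul_eq_zero.1 h with h | h
    · exact Or.inr (Or.inl (by linarith))
    · exact Or.inr (Or.inr (by linarith))

variable {J : EuclideanJordanAlgebra V} {ι : Type*} [Fintype ι] {c : ι → V}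

/-- A joint eigenvector of the `L(cᵢ)` lies in one of the Peirce spaces `V_ij`. -/
theorem CompleteSystem.exists_peirce (hc : J.CompleteSystem c) {v : V} (hv : v ≠ 0) {ε : ι → ℝ}
    (h : ∀ i, J.L (c i) v = ε i • v) :
    ∃ i j, ∀ a : ι → ℝ, J.L (∑ k, a k • c k) v = ((a i + a j) / 2) • v := by
  classical
  have hL : ∀ a : ι → ℝ, J.L (∑ k, a k • c k) v = (∑ k, a k * ε k) • v := by
    intro a
    simp [LinearMap.sum_apply, h, smul_smul, Finset.sum_smul]
  -- Sums of two or three distinct `cᵢ` are again idempotents, so the matching sums of `ε` lie in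
  -- `{0, 1/2, 1}`. With total `1`, this leaves one entry `1` or two entries `1/2`.
  have h1 : ∑ k, ε k = 1 := by
    have := hL 1
    simp only [Pi.one_apply, one_smul, hc.sum_eq, J.unit_mul, one_mul] at this
    exact (smul_left_injective ℝ hv (by simpa using this)).symm
  have hone := fun i => J.eigenvalue_idempotent (hc.idem i) hv (h i)
  have htwo : ∀ i j, i ≠ j → ε i + ε j = 0 ∨ ε i + ε j = 1 / 2 ∨ ε i + ε j = 1 := by
    intro i j hij
    refine J.eigenvalue_idempotent (d := c i + c j) ?_ hv ?_
    · simp [hc.mul_eq, hij, hij.symm]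
    · simp [h, add_smul]
  have hthree : ∀ i j k, i ≠ j → i ≠ k → j ≠ k →
      ε i + ε j + ε k = 0 ∨ ε i + ε j + ε k = 1 / 2 ∨ ε i + ε j + ε k = 1 := by
    intro i j k hij hik hjk
    refine J.eigenvalue_idempotent (d := c i + c j + c k) ?_ hv ?_
    · simp [hc.mul_eq, hij, hij.symm, hik, hik.symm, hjk, hjk.symm]
    · simp [h, add_smul]
  obtain ⟨i, hi⟩ : ∃ i, ε i ≠ 0 := by
    by_contra! hall
    simp [hall] at h1
  rcases hone i with hi0 | hi2 | hi1
  · exact absurd hi0 hi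
  · obtain ⟨j, hji, hj⟩ : ∃ j, j ≠ i ∧ ε j ≠ 0 := by
      by_contra! hall
      rw [Finset.sum_eq_single i (fun j _ hj => hall j hj) (by simp), hi2] at h1
      norm_num at h1
    have hj2 : ε j = 1 / 2 := by
      rcases hone j with h | h | h
      · exact absurd h hj
      · exact h
      · rcases htwo i j hji.symm with h' | h' | h' <;> linarith
    refine ⟨i, j, fun a => ?_⟩
    rw [hL, Fintype.sum_eq_add i j hji.symm, hi2, hj2]
    · congr 1; ring
    · rintro k ⟨hki, hkj⟩
      have : ε k = 0 := by
        rcases hone k with h | h | h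
        · exact h
        all_goals rcases hthree i j k hji.symm hki.symm hkj.symm with h' | h' | h' <;> linarith
      rw [this, mul_zero]
  · refine ⟨i, i, fun a => ?_⟩
    rw [hL, Finset.sum_eq_single i, hi1]
    · congr 1; ring
    · intro k _ hki
      have : ε k = 0 := by
        rcases hone k with h | h | h
        · exact h
        all_goals rcases htwo i k hki.symm with h' | h' | h' <;> linarith
      rw [this, mul_zero]
    · simp

theorem CompleteSystem.P_apply_peirce (hc : J.CompleteSystem c) {v : V} {i j : ι}
    (h : ∀ a : ι → ℝ, J.L (∑ k, a k • c k) v = ((a i + a j) / 2) • v) (a : ι → ℝ) :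
    J.P (∑ k, a k • c k) v = (a i * a j) • v := by
  rw [P]
  simp only [LinearMap.sub_apply, LinearMap.smul_apply, LinearMap.comp_apply, hc.mul_sum_smul]
  rw [h a, map_smul, h a, h fun k => a k * a k]
  module

variable [FiniteDimensional ℝ V]

theorem CompleteSystem.peirce_induction (hc : J.CompleteSystem c) {p : V → Prop} (zero : p 0)
    (add : ∀ u v, p u → p v → p (u + v))
    (peirce : ∀ v i j, (∀ a : ι → ℝ, J.L (∑ k, a k • c k) v = ((a i + a j) / 2) • v) → p v)
    (v : V) : p v := by
  have htop := LinearMap.IsSymmetric.iSup_iInf_eq_top_of_commute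
    (T := fun i => J.L (c i)) (fun i => J.isSymmetric_L (c i))
    (fun i j hij => J.commute_L_of_orthogonal (hc.idem i) (hc.orth i j hij))
  have hv : v ∈ ⨆ χ : ι → ℝ, ⨅ i, Module.End.eigenspace (J.L (c i)) (χ i) := by
    rw [htop]; trivial
  induction hv using Submodule.iSup_induction' with
  | mem χ x hx =>
    rw [Submodule.mem_iInf] at hx
    by_cases hx0 : x = 0
    · rwa [hx0]
    · obtain ⟨i, j, h⟩ := hc.exists_peirce hx0 fun i => Module.End.mem_eigenspace_iff.1 (hx i)
      exact peirce x i j h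
  | zero => exact zero
  | add x y _ _ hx hy => exact add x y hx hy

theorem CompleteSystem.P_P_inv (hc : J.CompleteSystem c) {a : ι → ℝ} (ha : ∀ i, a i ≠ 0) (v : V) :
    J.P (∑ i, a i • c i) (J.P (∑ i, (a i)⁻¹ • c i) v) = v := by
  induction v using hc.peirce_induction with
  | zero => simp
  | add u v hu hv => rw [map_add, map_add, hu, hv]
  | peirce v i j h =>
    rw [hc.P_apply_peirce h fun k => (a k)⁻¹, map_smul, hc.P_apply_peirce h, smul_smul]
    have h1 := ha i
    have h2 := ha j
    have : (a i)⁻¹ * (a j)⁻¹ * (a i * a j) = 1 := by field_simp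
    rw [this, one_smul]

/-- This is `P(exp(t b)) = exp(2t L(b))` in differential form; on a Peirce space both sides are
scalar. -/
theorem CompleteSystem.hasDerivAt_P_exp (hc : J.CompleteSystem c) (b : ι → ℝ) (v : V) (t : ℝ) :
    HasDerivAt (fun s => J.P (∑ i, Real.exp (s * b i) • c i) v)
      ((2 : ℝ) • J.L (∑ i, b i • c i) (J.P (∑ i, Real.exp (t * b i) • c i) v)) t := by
  induction v using hc.peirce_induction with
  | zero => simpa using hasDerivAt_const t (0 : V)
  | add u v hu hv =>
    simp only [map_add, smul_add]
    exact hu.add hv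
  | peirce v i j h =>
    have h1 : ∀ s : ℝ, J.P (∑ i, Real.exp (s * b i) • c i) v =
        Real.exp (s * (b i + b j)) • v := by
      intro s
      rw [hc.P_apply_peirce h fun k => Real.exp (s * b k), ← Real.exp_add, mul_add]
    simp only [h1, map_smul, h]
    have h2 : HasDerivAt (fun s : ℝ => Real.exp (s * (b i + b j)))
        (Real.exp (t * (b i + b j)) * (1 * (b i + b j))) t :=
      ((hasDerivAt_id t).mul_const (b i + b j)).exp
    convert h2.smul_const v using 1
    module

/-! ### Invariance of the cone -/

/-- The cone of squares is invariant under the flow of `w' = 2 b • w`. -/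
theorem mem_cone_of_hasDerivAt (J : EuclideanJordanAlgebra V) (b : V) {w : ℝ → V}
    (hw : ∀ t, HasDerivAt w ((2 : ℝ) • J.L b (w t)) t) (h0 : w 0 ∈ J.cone) : w 1 ∈ J.cone := by
  have hne : J.cone.Nonempty := ⟨_, h0⟩
  obtain ⟨C, hC⟩ : ∃ C : ℝ, ∀ x, ‖J.L b x‖ ≤ C * ‖x‖ :=
    ⟨‖LinearMap.toContinuousLinearMap (J.L b)‖, (LinearMap.toContinuousLinearMap (J.L b)).le_opNorm⟩
  let f : ℝ → ℝ := fun t => Metric.infDist (w t) J.cone ^ 2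
  have hcont : Continuous w := continuous_iff_continuousAt.2 fun t => (hw t).continuousAt
  have hf : Continuous f := ((Metric.continuous_infDist_pt _).comp hcont).pow 2
  have hstep : ∀ t r, 4 * C * f t < r → ∃ᶠ z in nhdsWithin t (Set.Ioi t),
      (z - t)⁻¹ * (f z - f t) < r := by
    intro t r hr
    obtain ⟨D⟩ := J.nonempty_spectralDecomposition (w t)
    have hc := D.completeSystem
    -- Positive and negative parts: `w t = p - m` with `p • m = 0`, so `p` is a nearest point of the
    -- cone and `‖m‖` is the distance.
    set p := ∑ i, max (D.eigenvalue i) 0 • D.c i with hp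
    set m := ∑ i, max (-D.eigenvalue i) 0 • D.c i with hm
    have hpK : p ∈ J.cone := hc.sum_mem_cone fun i => le_max_right _ _
    have hmK : m ∈ J.cone := hc.sum_mem_cone fun i => le_max_right _ _
    have hpm : w t = p - m := by
      rw [hp, hm, ← Finset.sum_sub_distrib]
      conv_lhs => rw [D.sum_eq]
      refine Finset.sum_congr rfl fun i _ => ?_
      rw [← sub_smul]
      congr 1
      rcases le_total (D.eigenvalue i) 0 with h | h
      · rw [max_eq_right h, max_eq_left (by linarith)]; ring
      · rw [max_eq_left h, max_eq_right (by linarith)]; ring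
    have hprod : J.L p m = 0 := by
      rw [hp, hm, hc.mul_sum_smul]
      refine Finset.sum_eq_zero fun i _ => ?_
      rcases le_total (D.eigenvalue i) 0 with h | h
      · rw [max_eq_right h, zero_mul, zero_smul]
      · rw [max_eq_right (b := (0 : ℝ)) (a := -D.eigenvalue i) (by linarith), mul_zero, zero_smul]
    have hpminner : inner ℝ p m = 0 := by
      rw [← J.mul_unit p, J.symm, hprod, inner_zero_right]
    have hdist : ∀ q ∈ J.cone, ‖m‖ ≤ dist (w t) q := by
      intro q hq
      have h1 : inner ℝ (q - w t) m = inner ℝ q m + ‖m‖ * ‖m‖ := by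
        rw [hpm, ← real_inner_self_eq_norm_mul_norm, inner_sub_left, inner_sub_left, hpminner]; ring
      have h2 := J.inner_nonneg hq hmK
      have h3 := real_inner_le_norm (q - w t) m
      rw [dist_comm, dist_eq_norm]
      rcases (norm_nonneg m).eq_or_lt with h | h
      · rw [← h]; positivity
      · exact le_of_mul_le_mul_right (by linarith) h
    have hft : f t = ‖m‖ ^ 2 := by
      have h1 : Metric.infDist (w t) J.cone ≤ ‖m‖ := by
        refine (Metric.infDist_le_dist_of_mem hpK).trans (le_of_eq ?_)
        rw [hpm, dist_eq_norm]; simp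
      have h2 : ‖m‖ ≤ Metric.infDist (w t) J.cone := (Metric.le_infDist hne).2 fun {q} hq => hdist q hq
      simp only [f]
      rw [le_antisymm h1 h2]
    -- With `p` frozen, `g` dominates `f` and touches it at `t`, so its derivative bounds the right
    -- difference quotients of `f`. As `⟨m, b • p⟩ = 0`, that derivative is `4⟨m, b • m⟩ ≤ 4C f(t)`,
    -- and Grönwall's inequality gives `f = 0`.
    let g : ℝ → ℝ := fun z => ‖w z - p‖ ^ 2
    have hgt : g t = f t := by rw [hft]; simp [g, hpm]
    have hfg : ∀ z, f z ≤ g z := by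
      intro z
      have := Metric.infDist_le_dist_of_mem (x := w z) hpK
      rw [dist_eq_norm] at this
      exact pow_le_pow_left₀ Metric.infDist_nonneg this 2
    have hgd : HasDerivAt g (2 * inner ℝ (w t - p) ((2 : ℝ) • J.L b (w t))) t :=
      ((hw t).sub_const p).norm_sq
    have hgle : 2 * inner ℝ (w t - p) ((2 : ℝ) • J.L b (w t)) ≤ 4 * C * f t := by
      have e1 : w t - p = -m := by rw [hpm]; abel
      have e2 : inner ℝ m (J.L b p) = 0 := by
        rw [J.mul_comm, ← J.symm, hprod, inner_zero_left]
      have e3 : inner ℝ m (J.L b m) ≤ ‖m‖ * (C * ‖m‖) :=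
        (real_inner_le_norm _ _).trans (mul_le_mul_of_nonneg_left (hC m) (norm_nonneg _))
      rw [e1, hpm, map_sub, inner_smul_right, inner_neg_left, inner_sub_right, e2, hft]
      linarith
    have hslope := (hasDerivAt_iff_tendsto_slope.1 hgd).mono_left
      (nhdsWithin_mono t (fun z (hz : z ∈ Set.Ioi t) => (ne_of_gt hz : z ≠ t)))
    have hev := hslope.eventually_lt_const (lt_of_le_of_lt hgle hr)
    refine Filter.Eventually.frequently ?_
    filter_upwards [hev, self_mem_nhdsWithin] with z hz hzt
    refine lt_of_le_of_lt ?_ hz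
    rw [slope_def_field, hgt, div_eq_inv_mul]
    exact mul_le_mul_of_nonneg_left (by linarith [hfg z]) (inv_nonneg.2 (sub_nonneg.2 (le_of_lt hzt)))
  have hG := le_gronwallBound_of_liminf_deriv_right_le (f := f) (f' := fun t => 4 * C * f t)
    (δ := 0) (K := 4 * C) (ε := 0) (a := 0) (b := 1) hf.continuousOn
    (fun t _ r hr => hstep t r hr)
    (by simp [f, Metric.infDist_zero_of_mem h0]) (fun t _ => by simp) 1 (by simp)
  have hb : gronwallBound 0 (4 * C) 0 (1 - 0) = 0 := by
    simp [gronwallBound_ε0_δ0]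
  rw [hb] at hG
  have h1 : Metric.infDist (w 1) J.cone = 0 := by
    have : f 1 = 0 := le_antisymm hG (sq_nonneg _)
    simpa [f] using this
  exact (J.isClosed_cone.mem_iff_infDist_zero hne).2 h1

theorem CompleteSystem.P_mem_cone (hc : J.CompleteSystem c) {a : ι → ℝ} (ha : ∀ i, 0 < a i)
    {u : V} (hu : u ∈ J.cone) : J.P (∑ i, a i • c i) u ∈ J.cone := by
  have h := J.mem_cone_of_hasDerivAt (∑ i, Real.log (a i) • c i)
    (w := fun s => J.P (∑ i, Real.exp (s * Real.log (a i)) • c i) u)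
    (hc.hasDerivAt_P_exp (fun i => Real.log (a i)) u)
    (by simpa [hc.sum_eq, P, J.L_unit, two_smul] using hu)
  simpa [Real.exp_log, ha] using h

/-- The quadratic representation of `y^{-1/2}` is an automorphism of the cone mapping `y` to the
unit. -/
theorem exists_P_invSqrt_equiv (J : EuclideanJordanAlgebra V) {y : V} (hy : y ∈ J.symmetricCone) :
    ∃ A : V ≃ₗ[ℝ] V, (∀ u, A u = J.P (J.invSqrt y) u) ∧ A y = J.e ∧
      ∀ u, A u ∈ J.cone ↔ u ∈ J.cone := by
  have hne := J.nonempty_spectralDecomposition y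
  set D := hne.some with hD
  have hc := D.completeSystem
  have hsum := D.sum_eq
  have hpos : ∀ i, 0 < D.eigenvalue i := by
    rw [hsum] at hy
    exact hc.sum_mem_symmetricCone_iff.1 hy
  let a : Fin D.k → ℝ := fun i => D.eigenvalue i ^ (-(1 / 2) : ℝ)
  have ha : ∀ i, 0 < a i := fun i => Real.rpow_pos_of_pos (hpos i) _
  have hinv : J.invSqrt y = ∑ i, a i • D.c i := by
    rw [invSqrt, calculus, dif_pos hne]
  have h1 := hc.P_P_inv (a := a) fun i => (ha i).ne'
  have h2 := hc.P_P_inv (a := fun i => (a i)⁻¹) fun i => inv_ne_zero (ha i).ne'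
  simp only [inv_inv] at h2
  refine ⟨LinearEquiv.ofLinearMap (J.P (∑ i, a i • D.c i)) (J.P (∑ i, (a i)⁻¹ • D.c i))
    (LinearMap.ext h1) (LinearMap.ext h2), ?_, ?_, ?_⟩
  · intro u; rw [hinv]; rfl
  · change J.P (∑ i, a i • D.c i) y = J.e
    have h3 : ∀ i, a i * a i * D.eigenvalue i = 1 := by
      intro i
      simp only [a]
      rw [← Real.rpow_add (hpos i)]
      norm_num
      rw [Real.rpow_neg_one, inv_mul_cancel₀ (hpos i).ne']
    refine (congrArg _ hsum).trans ?_
    rw [P, LinearMap.sub_apply, LinearMap.smul_apply, LinearMap.comp_apply, hc.mul_sum_smul,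
      hc.mul_sum_smul, hc.mul_sum_smul, hc.mul_sum_smul]
    simp only [← _root_.mul_assoc, h3, one_smul, hc.sum_eq]
    module
  · intro u
    refine ⟨fun h => ?_, fun h => hc.P_mem_cone ha h⟩
    have h4 := hc.P_mem_cone (fun i => inv_pos.2 (ha i)) h
    change J.P _ (J.P (∑ i, a i • D.c i) u) ∈ J.cone at h4
    rwa [h2] at h4

theorem map_mem_symmetricCone_iff (A : V ≃ₗ[ℝ] V) (hA : ∀ u, A u ∈ J.cone ↔ u ∈ J.cone) (u : V) :
    A u ∈ J.symmetricCone ↔ u ∈ J.symmetricCone := by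
  have h : A.toContinuousLinearEquiv.toHomeomorph ⁻¹' J.cone = J.cone := by
    ext v; exact hA v
  have h1 := A.toContinuousLinearEquiv.toHomeomorph.preimage_interior J.cone
  rw [h] at h1
  exact Set.ext_iff.1 h1 u

end EuclideanJordanAlgebra

namespace EuclideanJordanAlgebra

variable {V : Type*} [NormedAddCommGroup V] [InnerProductSpace ℝ V]
  {J : EuclideanJordanAlgebra V}

/-! ### Hilbert's metric on the symmetric cone -/

theorem unit_ne_zero [Nontrivial V] (J : EuclideanJordanAlgebra V) : J.e ≠ 0 := by
  intro h
  obtain ⟨x, hx⟩ := exists_ne (0 : V)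
  apply hx
  rw [← J.unit_mul x, h, map_zero, LinearMap.zero_apply]

theorem coneM_le {u v : V} {β : ℝ} (hβ : 0 < β) (h : β • v - u ∈ J.cone) :
    coneM J.cone u v ≤ β :=
  csInf_le ⟨0, fun _ h => h.1.le⟩ ⟨hβ, h⟩

theorem hilbertMetric_map {A : V ≃ₗ[ℝ] V} (hA : ∀ u, A u ∈ J.cone ↔ u ∈ J.cone) (u v : V) :
    hilbertMetric J.cone (A u) (A v) = hilbertMetric J.cone u v := by
  simp only [hilbertMetric, coneM, ← map_smul, ← map_sub, hA]

theorem hilbertMetric_comm (C : Set V) (u v : V) : hilbertMetric C u v = hilbertMetric C v u := by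
  rw [hilbertMetric, hilbertMetric, _root_.mul_comm]

/-- The positive multiple of `u` in the slice determined by `φ`. -/
noncomputable def normalize (φ u : V) : V := (inner ℝ φ u)⁻¹ • u

theorem normalize_smul_of_mem_slice {φ u : V} (hu : u ∈ J.slice φ) {r : ℝ} (hr : 0 < r) :
    normalize φ (r • u) = u := by
  rw [normalize, inner_smul_right, hu.2, mul_one, smul_smul, inv_mul_cancel₀ hr.ne', one_smul]

variable [FiniteDimensional ℝ V]

theorem ne_zero_of_mem_symmetricCone [Nontrivial V] {u : V} (hu : u ∈ J.symmetricCone) :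
    u ≠ 0 := by
  rintro rfl
  obtain ⟨ε, hε, h⟩ := J.exists_sub_smul_mem_cone hu J.e
  rw [zero_sub] at h
  have h1 := J.eq_zero_of_mem_cone_of_neg_mem_cone
    (J.smul_mem_cone hε.le (J.symmetricCone_subset J.unit_mem_symmetricCone)) h
  exact J.unit_ne_zero ((smul_eq_zero.1 h1).resolve_left hε.ne')

theorem inner_pos' [Nontrivial V] {φ u : V} (hφ : φ ∈ J.symmetricCone)
    (hu : u ∈ J.symmetricCone) : 0 < inner ℝ φ u :=
  J.inner_pos hφ (J.symmetricCone_subset hu) (ne_zero_of_mem_symmetricCone hu)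

theorem coneM_mem_and_pos [Nontrivial V] {u v : V} (hu : u ∈ J.symmetricCone)
    (hv : v ∈ J.symmetricCone) :
    coneM J.cone u v • v - u ∈ J.cone ∧ 0 < coneM J.cone u v := by
  have hu1 := inner_pos' J.unit_mem_symmetricCone hu
  have hv1 := inner_pos' J.unit_mem_symmetricCone hv
  have hL : 0 < inner ℝ J.e u / inner ℝ J.e v := div_pos hu1 hv1
  -- Pairing with `e` bounds admissible `β` away from `0`, so the set is closed and the infimum is
  -- attained.
  have hS : {β : ℝ | 0 < β ∧ β • v - u ∈ J.cone} =
      Set.Ici (inner ℝ J.e u / inner ℝ J.e v) ∩ (fun β : ℝ => β • v - u) ⁻¹' J.cone := by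
    ext β
    constructor
    · rintro ⟨_, h⟩
      refine ⟨?_, h⟩
      have h1 := J.inner_nonneg (J.symmetricCone_subset J.unit_mem_symmetricCone) h
      rw [inner_sub_right, inner_smul_right] at h1
      rw [Set.mem_Ici, div_le_iff₀ hv1]
      linarith
    · rintro ⟨h1, h⟩
      exact ⟨lt_of_lt_of_le hL h1, h⟩
  have hclosed : IsClosed {β : ℝ | 0 < β ∧ β • v - u ∈ J.cone} := by
    rw [hS]
    exact isClosed_Ici.inter (J.isClosed_cone.preimage (by fun_prop))
  have hne : {β : ℝ | 0 < β ∧ β • v - u ∈ J.cone}.Nonempty := by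
    obtain ⟨ε, hε, h⟩ := J.exists_sub_smul_mem_cone hv u
    refine ⟨ε⁻¹, inv_pos.2 hε, ?_⟩
    have h1 := J.smul_mem_cone (inv_pos.2 hε).le h
    rwa [smul_sub, smul_smul, inv_mul_cancel₀ hε.ne', one_smul] at h1
  have := hclosed.csInf_mem hne ⟨0, fun _ h => h.1.le⟩
  exact ⟨this.2, this.1⟩

theorem coneM_mem [Nontrivial V] {u v : V} (hu : u ∈ J.symmetricCone)
    (hv : v ∈ J.symmetricCone) : coneM J.cone u v • v - u ∈ J.cone :=
  (coneM_mem_and_pos hu hv).1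

theorem coneM_pos [Nontrivial V] {u v : V} (hu : u ∈ J.symmetricCone)
    (hv : v ∈ J.symmetricCone) : 0 < coneM J.cone u v :=
  (coneM_mem_and_pos hu hv).2

theorem coneM_eq [Nontrivial V] {u v : V} (hu : u ∈ J.symmetricCone)
    (hv : v ∈ J.symmetricCone) {r : ℝ} (hr : 0 < r) (h : r • v - u ∈ J.cone)
    (hle : ∀ β : ℝ, 0 < β → β • v - u ∈ J.cone → r ≤ β) : coneM J.cone u v = r :=
  le_antisymm (coneM_le hr h) (hle _ (coneM_pos hu hv) (coneM_mem hu hv))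

theorem coneM_le_mul [Nontrivial V] {u v w : V} (hu : u ∈ J.symmetricCone)
    (hv : v ∈ J.symmetricCone) (hw : w ∈ J.symmetricCone) :
    coneM J.cone u w ≤ coneM J.cone u v * coneM J.cone v w := by
  apply coneM_le (mul_pos (coneM_pos hu hv) (coneM_pos hv hw))
  have h := J.add_mem_cone (J.smul_mem_cone (coneM_pos hu hv).le (coneM_mem hv hw)) (coneM_mem hu hv)
  convert h using 1
  module

theorem coneM_smul [Nontrivial V] {u v : V} (hu : u ∈ J.symmetricCone)
    (hv : v ∈ J.symmetricCone) {s t : ℝ} (hs : 0 < s) (ht : 0 < t) :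
    coneM J.cone (s • u) (t • v) = s / t * coneM J.cone u v := by
  apply coneM_eq (J.smul_mem_symmetricCone hs hu) (J.smul_mem_symmetricCone ht hv)
    (mul_pos (div_pos hs ht) (coneM_pos hu hv))
  · have h := J.smul_mem_cone hs.le (coneM_mem hu hv)
    convert h using 1
    rw [smul_smul, smul_sub, smul_smul]
    congr 2
    field_simp
  · intro β hβ h
    have h1 := J.smul_mem_cone (inv_pos.2 hs).le h
    rw [smul_sub, smul_smul, smul_smul, smul_smul, inv_mul_cancel₀ hs.ne', one_smul] at h1
    have h2 := coneM_le (by positivity) h1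
    calc s / t * coneM J.cone u v ≤ s / t * (s⁻¹ * β * t) :=
          mul_le_mul_of_nonneg_left h2 (by positivity)
      _ = β := by field_simp

theorem hilbertMetric_smul [Nontrivial V] {u v : V} (hu : u ∈ J.symmetricCone)
    (hv : v ∈ J.symmetricCone) {s t : ℝ} (hs : 0 < s) (ht : 0 < t) :
    hilbertMetric J.cone (s • u) (t • v) = hilbertMetric J.cone u v := by
  rw [hilbertMetric, hilbertMetric, coneM_smul hu hv hs ht, coneM_smul hv hu ht hs]
  congr 1
  field_simp

theorem exp_hilbertMetric [Nontrivial V] {u v : V} (hu : u ∈ J.symmetricCone)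
    (hv : v ∈ J.symmetricCone) :
    Real.exp (hilbertMetric J.cone u v) = coneM J.cone u v * coneM J.cone v u :=
  Real.exp_log (mul_pos (coneM_pos hu hv) (coneM_pos hv hu))

theorem CompleteSystem.coneM_sum [Nontrivial V] {ι : Type*} [Fintype ι] {c : ι → V}
    (hc : J.CompleteSystem c) {a b : ι → ℝ} (ha : ∀ i, 0 < a i) (hb : ∀ i, 0 < b i) {r : ℝ}
    (h : ∀ i, b i ≤ r * a i) {i : ι} (hi : b i = r * a i) :
    coneM J.cone (∑ i, b i • c i) (∑ i, a i • c i) = r := by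
  have key : ∀ β : ℝ, β • ∑ i, a i • c i - ∑ i, b i • c i = ∑ i, (β * a i - b i) • c i := by
    intro β
    rw [Finset.smul_sum, ← Finset.sum_sub_distrib]
    simp [sub_smul, smul_smul]
  have hr : 0 < r := pos_of_mul_pos_left (hi ▸ hb i) (ha i).le
  apply coneM_eq (hc.sum_mem_symmetricCone_iff.2 hb) (hc.sum_mem_symmetricCone_iff.2 ha) hr
  · rw [key, hc.sum_mem_cone_iff]
    intro j; linarith [h j]
  · intro β _ hβ
    rw [key, hc.sum_mem_cone_iff] at hβ
    have := hβ i
    rw [hi] at this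
    exact le_of_mul_le_mul_right (by linarith) (ha i)

/-! ### Geodesics -/

/-- A path of positive coefficients from `1` to `lam / lam i₀` along which the extreme ratios of
coefficients are attained at the indices `i₀` and `i₁`. -/
structure CoeffPath {ι : Type*} (lam : ι → ℝ) (i₀ i₁ : ι) (T : ℝ) (f : ℝ → ι → ℝ) : Prop where
  at_min : ∀ t, f t i₀ = 1
  at_max : ∀ t, f t i₁ = Real.exp t
  pos : ∀ t i, 0 < f t i
  mono : ∀ s t, s ≤ t → ∀ i, f s i ≤ f t i
  le_exp : ∀ s t, s ≤ t → ∀ i, f t i ≤ Real.exp (t - s) * f s i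
  zero : ∀ i, f 0 i = 1
  final : ∀ i, f T i = lam i / lam i₀

theorem CoeffPath.hilbertMetric_sum [Nontrivial V] {ι : Type*} [Fintype ι] {c : ι → V}
    (hc : J.CompleteSystem c) {lam : ι → ℝ} {i₀ i₁ : ι} {T : ℝ} {f : ℝ → ι → ℝ}
    (hf : CoeffPath lam i₀ i₁ T f) (s t : ℝ) :
    hilbertMetric J.cone (∑ i, f s i • c i) (∑ i, f t i • c i) = |s - t| := by
  wlog hst : s ≤ t generalizing s t
  · rw [hilbertMetric_comm, this t s (le_of_not_ge hst), abs_sub_comm]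
  have h1 : coneM J.cone (∑ i, f s i • c i) (∑ i, f t i • c i) = 1 :=
    hc.coneM_sum (hf.pos t) (hf.pos s) (fun i => by rw [one_mul]; exact hf.mono s t hst i)
      (i := i₀) (by rw [hf.at_min, hf.at_min, one_mul])
  have h2 : coneM J.cone (∑ i, f t i • c i) (∑ i, f s i • c i) = Real.exp (t - s) :=
    hc.coneM_sum (hf.pos s) (hf.pos t) (hf.le_exp s t hst)
      (i := i₁) (by rw [hf.at_max, hf.at_max, ← Real.exp_add, sub_add_cancel])
  rw [hilbertMetric, h1, h2, one_mul, Real.log_exp, abs_sub_comm, abs_of_nonneg (by linarith)]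

theorem normalize_mem_slice [Nontrivial V] {φ u : V} (hφ : φ ∈ J.symmetricCone)
    (hu : u ∈ J.symmetricCone) : normalize φ u ∈ J.slice φ := by
  have h := inner_pos' hφ hu
  refine ⟨J.smul_mem_symmetricCone (inv_pos.2 h) hu, ?_⟩
  rw [normalize, inner_smul_right, inv_mul_cancel₀ h.ne']

/-- The point of the slice with given coefficients with respect to the system `A⁻¹ c`. -/
noncomputable def slicePoint {ι : Type*} [Fintype ι] (φ : V) (A : V ≃ₗ[ℝ] V) (c : ι → V)
    (a : ι → ℝ) : V :=
  normalize φ (A.symm (∑ i, a i • c i))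

theorem CoeffPath.isGeodesicSegment [Nontrivial V] {ι : Type*} [Fintype ι] {c : ι → V}
    (hc : J.CompleteSystem c) {lam : ι → ℝ} {i₀ i₁ : ι} {T : ℝ} (hT : 0 ≤ T) {f : ℝ → ι → ℝ}
    (hf : CoeffPath lam i₀ i₁ T f) {φ x y : V} (hφ : φ ∈ J.symmetricCone) (hx : x ∈ J.slice φ)
    (hy : y ∈ J.slice φ) {A : V ≃ₗ[ℝ] V} (hA : ∀ u, A u ∈ J.cone ↔ u ∈ J.cone) (hAy : A y = J.e)
    (hAx : A x = ∑ i, lam i • c i) (h₀ : 0 < lam i₀) :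
    IsGeodesicSegment (J.slice φ) (hilbertMetric J.cone) x y
      ((fun t => slicePoint φ A c (f t)) '' Set.Icc 0 T) := by
  have hmem : ∀ t, A.symm (∑ i, f t i • c i) ∈ J.symmetricCone := by
    intro t
    rw [← map_mem_symmetricCone_iff A hA, A.apply_symm_apply]
    exact hc.sum_mem_symmetricCone_iff.2 (hf.pos t)
  -- Coefficient paths run from `y` to `x`, so time is reversed.
  refine ⟨0, T, fun t => slicePoint φ A c (f (T - t)), hT,
    fun t _ => normalize_mem_slice hφ (hmem _), ?_, ?_, ?_, ?_⟩
  · intro s _ t _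
    simp only [slicePoint, normalize]
    rw [hilbertMetric_smul (hmem _) (hmem _) (inv_pos.2 (inner_pos' hφ (hmem _)))
      (inv_pos.2 (inner_pos' hφ (hmem _))), ← hilbertMetric_map hA, A.apply_symm_apply,
      A.apply_symm_apply, hf.hilbertMetric_sum hc, abs_sub_comm]
    congr 1; ring
  · have h1 : ∑ i, f T i • c i = A ((lam i₀)⁻¹ • x) := by
      rw [map_smul, hAx, Finset.smul_sum]
      simp only [hf.final, smul_smul, div_eq_inv_mul]
    simp only [sub_zero, slicePoint]
    rw [h1, A.symm_apply_apply, normalize_smul_of_mem_slice hx (inv_pos.2 h₀)]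
  · have h1 : ∑ i, f 0 i • c i = A ((1 : ℝ) • y) := by
      rw [one_smul, hAy, ← hc.sum_eq]
      simp only [hf.zero, one_smul]
    simp only [sub_self, slicePoint]
    rw [h1, A.symm_apply_apply, normalize_smul_of_mem_slice hy one_pos]
  · have := Set.image_image (fun t => slicePoint φ A c (f t)) (fun t => T - t) (Set.Icc 0 T)
    rw [← this, Set.image_const_sub_Icc, sub_self, sub_zero]

/-- The coefficients of the straight line segment. -/
theorem coeffPath_linear {ι : Type*} {lam : ι → ℝ} {i₀ i₁ : ι} (h₀ : 0 < lam i₀)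
    (hmin : ∀ i, lam i₀ ≤ lam i) (hmax : ∀ i, lam i ≤ lam i₁) (hlt : lam i₀ < lam i₁) :
    CoeffPath lam i₀ i₁ (Real.log (lam i₁ / lam i₀)) fun t i =>
      ((lam i₁ - lam i) + Real.exp t * (lam i - lam i₀)) / (lam i₁ - lam i₀) := by
  have hd : 0 < lam i₁ - lam i₀ := sub_pos.2 hlt
  have h1 : 0 < lam i₁ := h₀.trans hlt
  refine ⟨fun t => ?_, fun t => ?_, fun t i => ?_, fun s t hst i => ?_, fun s t hst i => ?_,
    fun i => ?_, fun i => ?_⟩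
  · rw [sub_self, mul_zero, add_zero, div_self hd.ne']
  · rw [sub_self, zero_add, mul_div_cancel_right₀ _ hd.ne']
  · apply div_pos _ hd
    rcases (hmin i).eq_or_lt with h | h
    · rw [← h]; simpa using hlt
    · exact add_pos_of_nonneg_of_pos (sub_nonneg.2 (hmax i))
        (mul_pos (Real.exp_pos t) (sub_pos.2 h))
  · have := hmin i
    gcongr
  · rw [← mul_div_assoc, mul_add, ← _root_.mul_assoc, ← Real.exp_add, sub_add_cancel]
    have := le_mul_of_one_le_left (sub_nonneg.2 (hmax i)) (Real.one_le_exp (sub_nonneg.2 hst))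
    gcongr
  · rw [Real.exp_zero, one_mul, sub_add_sub_cancel, div_self hd.ne']
  · rw [Real.exp_log (div_pos h1 h₀)]
    field_simp
    ring

/-- The coefficients of the geometric path. -/
theorem coeffPath_power {ι : Type*} {lam : ι → ℝ} {i₀ i₁ : ι} (h₀ : 0 < lam i₀)
    (hmin : ∀ i, lam i₀ ≤ lam i) (hmax : ∀ i, lam i ≤ lam i₁) (hlt : lam i₀ < lam i₁) :
    CoeffPath lam i₀ i₁ (Real.log (lam i₁ / lam i₀)) fun t i =>
      Real.exp (t * (Real.log (lam i / lam i₀) / Real.log (lam i₁ / lam i₀))) := by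
  have hT : 0 < Real.log (lam i₁ / lam i₀) := Real.log_pos ((one_lt_div h₀).2 hlt)
  have hi : ∀ i, 0 ≤ Real.log (lam i / lam i₀) / Real.log (lam i₁ / lam i₀) := fun i =>
    div_nonneg (Real.log_nonneg ((one_le_div h₀).2 (hmin i))) hT.le
  have hi1 : ∀ i, Real.log (lam i / lam i₀) / Real.log (lam i₁ / lam i₀) ≤ 1 := fun i => by
    rw [div_le_one hT]
    have := h₀.trans_le (hmin i)
    exact Real.log_le_log (div_pos this h₀) (by gcongr; exact hmax i)
  refine ⟨fun t => ?_, fun t => ?_, fun t i => Real.exp_pos _, fun s t hst i => ?_,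
    fun s t hst i => ?_, fun i => ?_, fun i => ?_⟩
  · simp [div_self h₀.ne']
  · rw [div_self hT.ne', mul_one]
  · exact Real.exp_le_exp.2 (mul_le_mul_of_nonneg_right hst (hi i))
  · rw [← Real.exp_add, Real.exp_le_exp]
    nlinarith [mul_le_mul_of_nonneg_left (hi1 i) (sub_nonneg.2 hst)]
  · simp
  · rw [mul_div_cancel₀ _ hT.ne', Real.exp_log (div_pos (h₀.trans_le (hmin i)) h₀)]

/-! ### Uniqueness for two eigenvalues -/

/-- From `0 ≤ p ≤ s c` and `c ⊥ d` comes `⟨p, d⟩ = 0`. Writing `p = x²`, this says `⟨d • x, x⟩ = 0`,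
whence `d • x = 0` and then `d • x² = 0`. -/
theorem L_eq_zero_of_le {c d p : V} (hd : J.L d d = d) (hcd : J.L c d = 0) (hp : p ∈ J.cone)
    {s : ℝ} (hs : s • c - p ∈ J.cone) : J.L d p = 0 := by
  have h0 : inner ℝ c d = 0 := by rw [← J.mul_unit c, J.symm, hcd, inner_zero_right]
  have hdK := J.idempotent_mem_cone hd
  have h1 := J.inner_nonneg hp hdK
  have h2 := J.inner_nonneg hs hdK
  rw [inner_sub_left, real_inner_smul_left, h0] at h2
  have h3 : inner ℝ p d = 0 := by linarith
  obtain ⟨x, rfl⟩ := hp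
  rw [J.symm, J.mul_comm x d, real_inner_comm] at h3
  exact J.L_mul_self_eq_zero hd (J.L_idempotent_eq_zero hd h3)

theorem eq_smul_of_hilbertMetric_add [Nontrivial V] {c d w : V} {α β : ℝ} (hα : 0 < α)
    (hc : J.L c c = c) (hd : J.L d d = d) (hcd : J.L c d = 0) (he : c + d = J.e)
    (hz : α • c + β • d ∈ J.symmetricCone) (hw : w ∈ J.symmetricCone)
    (hβ : coneM J.cone (α • c + β • d) J.e = β) (hα' : coneM J.cone J.e (α • c + β • d) = α⁻¹)
    (h : hilbertMetric J.cone (α • c + β • d) w + hilbertMetric J.cone w J.e =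
      Real.log (β / α)) :
    ∃ m : ℝ, 0 < m ∧ w = m • (c + Real.exp (hilbertMetric J.cone w J.e) • d) := by
  set z := α • c + β • d with hzdef
  have heK := J.unit_mem_symmetricCone
  have hdc : J.L d c = 0 := by rw [J.mul_comm, hcd]
  have hβ0 : 0 < β := hβ ▸ coneM_pos hz heK
  have k1 := coneM_le_mul hz hw heK
  have k2 := coneM_le_mul heK hw hz
  have h' := congrArg Real.exp h
  rw [Real.exp_add, exp_hilbertMetric hz hw, exp_hilbertMetric hw heK,
    Real.exp_log (div_pos hβ0 hα)] at h'
  rw [exp_hilbertMetric hw heK]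
  rw [hβ] at k1
  rw [hα'] at k2
  have m1 := coneM_mem hz hw
  have m2 := coneM_mem hw hz
  have m3 := coneM_mem hw heK
  have m4 := coneM_mem heK hw
  have p1 := coneM_pos hz hw
  have p2 := coneM_pos hw hz
  have p3 := coneM_pos hw heK
  have p4 := coneM_pos heK hw
  set a₁ := coneM J.cone z w
  set b₁ := coneM J.cone w z
  set a₂ := coneM J.cone w J.e
  set b₂ := coneM J.cone J.e w
  have hprod : (a₁ * a₂) * (b₂ * b₁) = β * α⁻¹ := by rw [← div_eq_mul_inv, ← h']; ring
  have hαi : 0 < α⁻¹ := inv_pos.2 hα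
  -- Both `a₁ a₂ ≥ β` and `b₂ b₁ ≥ α⁻¹`, while the product of the two left sides is `β α⁻¹`; so both
  -- are equalities.
  have e1 : a₁ * a₂ = β := by
    refine le_antisymm ?_ k1
    by_contra! hlt
    have := mul_lt_mul hlt k2 hαi (by positivity)
    linarith
  have e2 : b₂ * b₁ = α⁻¹ := by
    rw [e1] at hprod
    exact mul_left_cancel₀ hβ0.ne' hprod
  -- Since `a₁ w ≥ z`, this vector is at most `β e - z = (β - α) c`. Dually, `b₂ w - e` is at most
  -- `α⁻¹ z - e`, a multiple of `d`.
  have hu : J.L d (a₁ • (a₂ • J.e - w)) = 0 := by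
    refine L_eq_zero_of_le hd hcd (J.smul_mem_cone p1.le m3) (s := β - α) ?_
    convert m1 using 1
    rw [smul_sub, smul_smul, e1, hzdef, ← he]
    module
  have hv : J.L c (b₂ • w - J.e) = 0 := by
    refine L_eq_zero_of_le hc hdc m4 (s := α⁻¹ * β - 1) ?_
    convert J.smul_mem_cone p4.le m2 using 1
    rw [smul_sub, smul_smul, e2, hzdef, ← he, smul_add, smul_smul, smul_smul,
      inv_mul_cancel₀ hα.ne']
    module
  have hdw : J.L d w = a₂ • d := by
    rw [map_smul, smul_eq_zero_iff_right p1.ne', map_sub, map_smul, J.mul_unit, sub_eq_zero] at hu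
    exact hu.symm
  have hcw : J.L c w = b₂⁻¹ • c := by
    rw [map_sub, map_smul, J.mul_unit, sub_eq_zero] at hv
    have h5 : J.L c w = b₂⁻¹ • (b₂ • J.L c w) := by
      rw [smul_smul, inv_mul_cancel₀ p4.ne', one_smul]
    rw [h5, hv]
  refine ⟨b₂⁻¹, inv_pos.2 p4, ?_⟩
  rw [← J.unit_mul w, ← he, map_add, LinearMap.add_apply, hdw, hcw, smul_add, smul_smul,
    _root_.mul_comm a₂ b₂, inv_mul_cancel_left₀ p4.ne']

end EuclideanJordanAlgebra

/-! ### Comparison of geodesic segments and the main theorem -/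

namespace EuclideanJordanAlgebra

variable {V : Type*} [NormedAddCommGroup V] [InnerProductSpace ℝ V] [FiniteDimensional ℝ V]
  {J : EuclideanJordanAlgebra V}

/-- If the geometric path and the straight segment have a common image, then every eigenvalue is
extreme. -/
theorem eq_or_eq_of_image_eq [Nontrivial V] {ι : Type*} [Fintype ι] {c : ι → V}
    (hc : J.CompleteSystem c) {lam : ι → ℝ} {i₀ i₁ : ι} (h₀ : 0 < lam i₀)
    (hmin : ∀ i, lam i₀ ≤ lam i) (hmax : ∀ i, lam i ≤ lam i₁) (hlt : lam i₀ < lam i₁)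
    {φ : V} (hφ : φ ∈ J.symmetricCone) {A : V ≃ₗ[ℝ] V} (hA : ∀ u, A u ∈ J.cone ↔ u ∈ J.cone)
    (h : (fun t => slicePoint φ A c fun i =>
          Real.exp (t * (Real.log (lam i / lam i₀) / Real.log (lam i₁ / lam i₀)))) ''
          Set.Icc 0 (Real.log (lam i₁ / lam i₀)) ⊆
        (fun t => slicePoint φ A c fun i =>
          ((lam i₁ - lam i) + Real.exp t * (lam i - lam i₀)) / (lam i₁ - lam i₀)) ''
          Set.Icc 0 (Real.log (lam i₁ / lam i₀))) (j : ι) :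
    lam j = lam i₀ ∨ lam j = lam i₁ := by
  have hp := coeffPath_power h₀ hmin hmax hlt
  have hl := coeffPath_linear h₀ hmin hmax hlt
  have hT : 0 < Real.log (lam i₁ / lam i₀) := Real.log_pos ((one_lt_div h₀).2 hlt)
  set T := Real.log (lam i₁ / lam i₀) with hTdef
  have hmem : ∀ a : ι → ℝ, (∀ i, 0 < a i) → A.symm (∑ i, a i • c i) ∈ J.symmetricCone := by
    intro a ha
    rw [← map_mem_symmetricCone_iff A hA, A.apply_symm_apply]
    exact hc.sum_mem_symmetricCone_iff.2 ha
  -- At parameter `T / 2` the geometric coefficients are the square roots of `lam i / lam i₀`, which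
  -- makes the comparison polynomial.
  obtain ⟨s, -, hs⟩ := h ⟨T / 2, ⟨by linarith, by linarith⟩, rfl⟩
  simp only [slicePoint, normalize] at hs
  have q1 := inner_pos' hφ (hmem _ (hl.pos s))
  have q2 := inner_pos' hφ (hmem _ (hp.pos (T / 2)))
  set κ₁ := inner ℝ φ (A.symm (∑ i,
    (((lam i₁ - lam i) + Real.exp s * (lam i - lam i₀)) / (lam i₁ - lam i₀)) • c i))
  set κ₂ := inner ℝ φ (A.symm (∑ i,
    Real.exp (T / 2 * (Real.log (lam i / lam i₀) / T)) • c i))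
  rw [← map_smul, ← map_smul] at hs
  have hs2 := A.symm.injective hs
  rw [Finset.smul_sum, Finset.smul_sum] at hs2
  simp only [smul_smul] at hs2
  have hco := fun i => hc.coeff_ext hs2 i
  -- Both paths have coefficient `1` at `i₀`, which equates the normalising factors; index `i₁` then
  -- equates the parameters.
  have hκ : κ₁⁻¹ = κ₂⁻¹ := by
    have := hco i₀
    rwa [hl.at_min, hp.at_min, mul_one, mul_one] at this
  have hco2 : ∀ i, ((lam i₁ - lam i) + Real.exp s * (lam i - lam i₀)) / (lam i₁ - lam i₀) =
      Real.exp (T / 2 * (Real.log (lam i / lam i₀) / T)) := by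
    intro i
    have := hco i
    rw [hκ] at this
    exact mul_left_cancel₀ (inv_pos.2 q2).ne' this
  have hexp : Real.exp s = Real.exp (T / 2) := by
    have := hco2 i₁
    rwa [hl.at_max, hp.at_max] at this
  have hpos : ∀ i, 0 < lam i := fun i => h₀.trans_le (hmin i)
  have hr : ∀ i, lam i = lam i₀ * Real.exp (T / 2 * (Real.log (lam i / lam i₀) / T)) ^ 2 := by
    intro i
    rw [← Real.exp_nat_mul]
    have : ((2 : ℕ) : ℝ) * (T / 2 * (Real.log (lam i / lam i₀) / T)) = Real.log (lam i / lam i₀) := by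
      push_cast; field_simp
    rw [this, Real.exp_log (div_pos (hpos i) h₀)]
    field_simp
  have hj := hco2 j
  rw [hexp] at hj
  have hrj := hr j
  have hr1 := hr i₁
  rw [hp.at_max] at hr1
  set r := Real.exp (T / 2 * (Real.log (lam j / lam i₀) / T))
  set R := Real.exp (T / 2)
  have hR1 : 1 < R := Real.one_lt_exp_iff.2 (by linarith)
  rw [div_eq_iff (sub_pos.2 hlt).ne', hrj, hr1] at hj
  have hfac : lam i₀ * ((R - 1) * ((r - 1) * (r - R))) = 0 := by linear_combination hj
  have h3 := (mul_eq_zero.1 ((mul_eq_zero.1 hfac).resolve_left h₀.ne')).resolve_left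
    (sub_pos.2 hR1).ne'
  rcases mul_eq_zero.1 h3 with h4 | h4
  · left
    rw [hrj, sub_eq_zero.1 h4]; ring
  · right
    rw [hrj, hr1, sub_eq_zero.1 h4]

/-- A geodesic segment between points with two relative eigenvalues is determined by them. -/
theorem eq_image_of_isGeodesicSegment [Nontrivial V] {c d : V} {α β : ℝ} (hα : 0 < α)
    (hc : J.L c c = c) (hd : J.L d d = d) (hcd : J.L c d = 0) (he : c + d = J.e)
    (hβ : coneM J.cone (α • c + β • d) J.e = β) (hα' : coneM J.cone J.e (α • c + β • d) = α⁻¹)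
    {φ x y : V} (hx : x ∈ J.slice φ) {A : V ≃ₗ[ℝ] V}
    (hA : ∀ u, A u ∈ J.cone ↔ u ∈ J.cone) (hAy : A y = J.e) (hAx : A x = α • c + β • d)
    {S : Set V} (hS : IsGeodesicSegment (J.slice φ) (hilbertMetric J.cone) x y S) :
    S = (fun t => normalize φ (A.symm (c + Real.exp t • d))) ''
      Set.Icc 0 (Real.log (β / α)) := by
  obtain ⟨a, b, γ, hab, hγ, hdist, ha, hb, rfl⟩ := hS
  have haI : a ∈ Set.Icc a b := Set.left_mem_Icc.2 hab
  have hbI : b ∈ Set.Icc a b := Set.right_mem_Icc.2 hab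
  have hz : α • c + β • d ∈ J.symmetricCone := by
    rw [← hAx, map_mem_symmetricCone_iff A hA]; exact hx.1
  -- The length of the parameter interval is forced by the distance from `x` to `y`.
  have hT : b - a = Real.log (β / α) := by
    have h1 := hdist a haI b hbI
    rw [ha, hb, ← hilbertMetric_map hA, hAx, hAy, hilbertMetric, hβ, hα', abs_sub_comm,
      abs_of_nonneg (sub_nonneg.2 hab)] at h1
    rw [← h1, div_eq_mul_inv]
  have key : ∀ t ∈ Set.Icc a b, γ t = normalize φ (A.symm (c + Real.exp (b - t) • d)) := by
    intro t ht
    have hw : A (γ t) ∈ J.symmetricCone := by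
      rw [map_mem_symmetricCone_iff A hA]; exact (hγ t ht).1
    have h1 : hilbertMetric J.cone (α • c + β • d) (A (γ t)) = t - a := by
      rw [← hAx, hilbertMetric_map hA, ← ha, hdist a haI t ht, abs_sub_comm,
        abs_of_nonneg (sub_nonneg.2 ht.1)]
    have h2 : hilbertMetric J.cone (A (γ t)) J.e = b - t := by
      rw [← hAy, hilbertMetric_map hA, ← hb, hdist t ht b hbI, abs_sub_comm,
        abs_of_nonneg (sub_nonneg.2 ht.2)]
    obtain ⟨m, hm, h3⟩ := eq_smul_of_hilbertMetric_add hα hc hd hcd he hz hw hβ hα'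
      (by rw [h1, h2, ← hT]; ring)
    rw [h2] at h3
    have h4 : A.symm (c + Real.exp (b - t) • d) = m⁻¹ • γ t := by
      rw [A.symm_apply_eq, map_smul, h3, smul_smul, inv_mul_cancel₀ hm.ne', one_smul]
    rw [h4, normalize_smul_of_mem_slice (hγ t ht) (inv_pos.2 hm)]
  rw [Set.image_congr key, ← hT]
  have := Set.image_image (fun t => normalize φ (A.symm (c + Real.exp t • d))) (fun t => b - t)
    (Set.Icc a b)
  rw [← this, Set.image_const_sub_Icc, sub_self]

end EuclideanJordanAlgebra

open EuclideanJordanAlgebra in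
theorem theorem6p3 {V : Type*} [NormedAddCommGroup V] [InnerProductSpace ℝ V]
    [FiniteDimensional ℝ V] (J : EuclideanJordanAlgebra V)
    (φ : V) (hφ : φ ∈ J.symmetricCone)
    (x y : V) (hx : x ∈ J.slice φ) (hy : y ∈ J.slice φ) (hxy : x ≠ y) :
    (∃! S : Set V, IsGeodesicSegment (J.slice φ) (hilbertMetric J.cone) x y S) ↔
      ∃ α β : ℝ, 0 < α ∧ α < β ∧ J.spectrum (J.P (J.invSqrt y) x) = {α, β} := by
  have : Nontrivial V := ⟨x, y, hxy⟩
  obtain ⟨A, hAP, hAy, hA⟩ := J.exists_P_invSqrt_equiv hy.1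
  rw [← hAP x]
  obtain ⟨D⟩ := J.nonempty_spectralDecomposition (A x)
  have hc := D.completeSystem
  have hAx := D.sum_eq
  have hpos : ∀ i, 0 < D.eigenvalue i := by
    have h := (map_mem_symmetricCone_iff A hA x).2 hx.1
    exact hc.sum_mem_symmetricCone_iff.1 (hAx ▸ h)
  have hne : Nonempty (Fin D.k) := by
    by_contra h
    rw [not_nonempty_iff] at h
    have := hc.sum_eq
    rw [Fintype.sum_empty] at this
    exact J.unit_ne_zero this.symm
  obtain ⟨i₀, hmin⟩ := Finite.exists_min D.eigenvalue
  obtain ⟨i₁, hmax⟩ := Finite.exists_max D.eigenvalue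
  have h₀ := hpos i₀
  -- A single eigenvalue would make `x` a multiple of `y`, and a ray meets the slice only once.
  have hlt : D.eigenvalue i₀ < D.eigenvalue i₁ := by
    by_contra! hle
    apply hxy
    have h1 : A x = A (D.eigenvalue i₀ • y) := by
      rw [map_smul, hAy, ← hc.sum_eq, Finset.smul_sum]
      refine hAx.trans (Finset.sum_congr rfl fun i _ => ?_)
      rw [le_antisymm ((hmax i).trans hle) (hmin i)]
    have h2 := A.injective h1
    rw [← normalize_smul_of_mem_slice hy h₀, ← h2, ← one_smul ℝ x,
      normalize_smul_of_mem_slice hx one_pos, one_smul]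
  have hT : 0 ≤ Real.log (D.eigenvalue i₁ / D.eigenvalue i₀) :=
    Real.log_nonneg ((one_le_div h₀).2 hlt.le)
  have hlin := (coeffPath_linear h₀ hmin hmax hlt).isGeodesicSegment hc hT hφ hx hy hA hAy hAx h₀
  have hpow := (coeffPath_power h₀ hmin hmax hlt).isGeodesicSegment hc hT hφ hx hy hA hAy hAx h₀
  rw [D.spectrum_eq]
  constructor
  · intro hS
    refine ⟨D.eigenvalue i₀, D.eigenvalue i₁, h₀, hlt, ?_⟩
    have hsub := (hS.unique hpow hlin).subset
    refine Set.Subset.antisymm ?_ ?_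
    · rintro _ ⟨j, rfl⟩
      exact eq_or_eq_of_image_eq hc h₀ hmin hmax hlt hφ hA hsub j
    · rintro _ (rfl | rfl)
      exacts [⟨i₀, rfl⟩, ⟨i₁, rfl⟩]
  · rintro ⟨α, β, hα, hαβ, hspec⟩
    have hmem : ∀ i, D.eigenvalue i = α ∨ D.eigenvalue i = β := fun i =>
      hspec.subset (Set.mem_range_self i)
    -- Eigenvalues are listed without repetition, so two values mean exactly two idempotents.
    have htwo : ∀ i, i = i₀ ∨ i = i₁ := by
      intro i
      have : D.eigenvalue i = D.eigenvalue i₀ ∨ D.eigenvalue i = D.eigenvalue i₁ := by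
        rcases hmem i with h | h <;> rcases hmem i₀ with h' | h' <;>
          rcases hmem i₁ with h'' | h'' <;> rw [h, h', h''] <;> simp <;> linarith
      exact this.imp (fun h => D.eigenvalue_injective h) fun h => D.eigenvalue_injective h
    have hne01 : i₀ ≠ i₁ := fun h => hlt.ne (congrArg _ h)
    have hsum : ∀ f : Fin D.k → V, ∑ i, f i = f i₀ + f i₁ := fun f =>
      Fintype.sum_eq_add i₀ i₁ hne01 fun i hi =>
        ((htwo i).elim hi.1 hi.2).elim
    have hone : J.e = ∑ i, (1 : ℝ) • D.c i := by simp [hc.sum_eq]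
    have hβ : coneM J.cone (∑ i, D.eigenvalue i • D.c i) J.e = D.eigenvalue i₁ := by
      rw [hone]
      exact hc.coneM_sum (fun _ => one_pos) hpos (fun i => by simpa using hmax i) (i := i₁)
        (by simp)
    have hα' : coneM J.cone J.e (∑ i, D.eigenvalue i • D.c i) = (D.eigenvalue i₀)⁻¹ := by
      rw [hone]
      refine hc.coneM_sum hpos (fun _ => one_pos) (fun i => ?_) (i := i₀)
        (inv_mul_cancel₀ h₀.ne').symm
      rw [← inv_mul_cancel₀ h₀.ne']
      exact mul_le_mul_of_nonneg_left (hmin i) (inv_pos.2 h₀).le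
    rw [hsum] at hβ hα'
    refine existsUnique_of_exists_of_unique ⟨_, hlin⟩ fun S S' hS hS' => ?_
    have huniq := fun S hS => eq_image_of_isGeodesicSegment (S := S) h₀ (hc.idem i₀) (hc.idem i₁)
      (hc.orth i₀ i₁ hne01) (by rw [← hc.sum_eq, hsum]) hβ hα' hx hA hAy
      (hAx.trans (hsum _)) hS
    rw [huniq S hS, huniq S' hS']
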